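/- Let $G$ be a (Hausdorff, second countable) Lie group of dimension $n$ with left Haar measure $\mu$ and Lie algebra $\mathfrak g$, let $L^2(G)=L^2(G,\mu)$, and fix an ordered basis $X_1,\dots,X_n$ of $\mathfrak g$. For $X\in\mathfrak g$ and $f:G\to\mathbb C$ put $D(X)f(x)=\frac{d}{dt}\big|_{t=0}f(x\exp(tX))$, and for a multi-index $\alpha=(\alpha(1),\dots,\alpha(k))$ with entries in $\{1,\dots,n\}$ and length $|\alpha|=k$ put $D^\alpha f=D(X_{\alpha(k)})\cdots D(X_{\alpha(1)})f$ (so $D^\alpha f=f$ if $|\alpha|=0$). For $\epsilon>0$ let $$U_\epsilon=\{\exp(t_1X_1)\cdots\exp(t_nX_n)\mid -\epsilon\le t_k\le\epsilon,\ 1\le k\le n\},\qquad \mathrm{osc}_\epsilon(f)(x)=\sup_{u\in U_\epsilon}|f(x)-f(xu^{-1})|\in[0,\infty].$$ Then there are constants $C_\epsilon\in[0,\infty)$, $\epsilon>0$, not depending on $f$, with $C_\epsilon\to0$ as $\epsilon\to0$, such that the following holds. Let $f:G\to\mathbb C$ be right differentiable of order $n$, that is, the derivatives $D^\alpha f$ exist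 at every point of $G$ for all $|\alpha|\le n$, and suppose that $D^\alpha f\in L^2(G)$ for all $|\alpha|\le n$. Then for every $\epsilon>0$ the function $\mathrm{osc}_\epsilon(f)$ is in $L^2(G)$ and $$\|\mathrm{osc}_\epsilon(f)\|_{L^2}\le C_\epsilon\sum_{1\le|\alpha|\le n}\|D^\alpha f\|_{L^2}.$$ -/

import Mathlib

open MeasureTheory Filter Topology
open scoped Manifold ContDiff ENNReal NNReal

section LieGroups

variable {E : Type*} [NormedAddCommGroup E] [NormedSpace ℝ E]
  {H : Type*} [TopologicalSpace H] {I : ModelWithCorners ℝ E H}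
  {G : Type*} [TopologicalSpace G] [ChartedSpace H G] [Group G] [LieGroup I ∞ G]

/-- Left-invariant vector fields are preserved by the differentials of left translations. -/
theorem mfderiv_mul_left_mulInvariantVectorField (g h : G) (v : GroupLieAlgebra I G) :
    mfderiv I I (g * ·) h (mulInvariantVectorField v h) = mulInvariantVectorField v (g * h) := by
  have key : ∀ a b : G, MDifferentiableAt I I (a * ·) b := fun a b =>
    (contMDiff_mul_left (I := I) (n := ∞) (a := a)).contMDiffAt.mdifferentiableAt (by simp)
  have D : (fun x : G => g * h * x) = (g * ·) ∘ (h * ·) := by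
    ext x; simp [mul_assoc]
  have h1 := mfderiv_comp_apply_of_eq (I' := I) (x := (1 : G)) (y := h)
    (key g h) (key h 1) (mul_one h) v
  rw [← D] at h1
  exact h1.symm

/-- Left translates of integral curves of left-invariant vector fields are integral curves. -/
theorem IsMIntegralCurveOn.mul_left_mulInvariantVectorField {γ : ℝ → G} {s : Set ℝ}
    {v : GroupLieAlgebra I G} (hγ : IsMIntegralCurveOn γ (mulInvariantVectorField v) s) (g : G) :
    IsMIntegralCurveOn (fun t => g * γ t) (mulInvariantVectorField v) s := by
  intro t ht
  have h1 := hγ t ht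
  have h2 : HasMFDerivAt I I (g * ·) (γ t) (mfderiv I I (g * ·) (γ t)) :=
    ((contMDiff_mul_left (I := I) (n := ∞) (a := g)).contMDiffAt.mdifferentiableAt
      (by simp)).hasMFDerivAt
  have h3 := h2.comp_hasMFDerivWithinAt t h1
  have h4 : (mfderiv I I (g * ·) (γ t)).comp
      ((1 : ℝ →L[ℝ] ℝ).smulRight (mulInvariantVectorField v (γ t))) =
      (1 : ℝ →L[ℝ] ℝ).smulRight (mulInvariantVectorField v (g * γ t)) := by
    rw [← mfderiv_mul_left_mulInvariantVectorField]
    ext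
    exact (mfderiv I I (g * ·) (γ t)).map_smul (1 : ℝ) (mulInvariantVectorField v (γ t))
  exact h4 ▸ h3

/-- Through the identity of a Lie group there is a globally defined integral curve of the
left-invariant vector field given by `v`, i.e. the one-parameter subgroup generated by `v`. -/
theorem exists_isMIntegralCurve_mulInvariantVectorField [FiniteDimensional ℝ E] [I.Boundaryless]
    [T2Space G] (v : GroupLieAlgebra I G) :
    ∃ γ : ℝ → G, γ 0 = 1 ∧ IsMIntegralCurve γ (mulInvariantVectorField v) := by
  have : CompleteSpace E := FiniteDimensional.complete ℝ E
  have : LieGroup I (minSmoothness ℝ 3) G := LieGroup.of_le (n := ∞)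
    (by simp only [minSmoothness_of_isRCLikeNormedField]; exact WithTop.coe_le_coe.2 le_top)
  have : IsManifold I 1 G := IsManifold.of_le (n := ∞) (by simp)
  have hv : ContMDiff I I.tangent 1
      (fun g : G => (mulInvariantVectorField v g : TangentBundle I G)) :=
    (contMDiff_mulInvariantVectorField v).of_le (by simp)
  obtain ⟨γ, h0, hγ⟩ :=
    exists_isMIntegralCurveAt_of_contMDiffAt_boundaryless (t₀ := 0) (hv.contMDiffAt (x := 1))
  obtain ⟨ε, hε, hγ⟩ := isMIntegralCurveAt_iff'.1 hγ
  rw [Real.ball_eq_Ioo, zero_sub, zero_add] at hγ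
  exact exists_isMIntegralCurve_of_isMIntegralCurveOn hv hε
    (fun x => ⟨fun t => x * γ t, by simp [h0], hγ.mul_left_mulInvariantVectorField x⟩) 1

variable [FiniteDimensional ℝ E] [I.Boundaryless] [T2Space G]

/-- The exponential map of a Lie group: `exp v = γ 1`, where `γ` is the integral curve with
`γ 0 = 1` of the left-invariant vector field given by `v`. -/
noncomputable def lieExp (v : GroupLieAlgebra I G) : G :=
  Classical.choose (exists_isMIntegralCurve_mulInvariantVectorField v) 1

/-- The left-invariant derivative `D(v) f (x) = d/dt f (x exp (t v))` at `t = 0`. -/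
noncomputable def invDeriv (v : GroupLieAlgebra I G) (f : G → ℂ) (x : G) : ℂ :=
  deriv (fun t : ℝ => f (x * lieExp (t • v))) 0

/-- For a multi-index `α` of length `k` with entries in `Fin n`,
`D^α f = D(X_{α(k)}) ⋯ D(X_{α(1)}) f` (here the entries are indexed from `0`). -/
noncomputable def iterInvDeriv {n : ℕ} (X : Fin n → GroupLieAlgebra I G) :
    (k : ℕ) → (Fin k → Fin n) → (G → ℂ) → (G → ℂ)
  | 0, _, f => f
  | k + 1, α, f => iterInvDeriv X k (fun i => α i.succ) (invDeriv (X (α 0)) f)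

/-- `f` is right differentiable of order `m`: the iterated derivatives `D^α f`, `|α| ≤ m`,
in the directions `X` exist at every point. -/
def RightDifferentiable {n : ℕ} (X : Fin n → GroupLieAlgebra I G) (m : ℕ) (f : G → ℂ) : Prop :=
  ∀ k < m, ∀ (α : Fin k → Fin n) (i : Fin n) (x : G),
    DifferentiableAt ℝ (fun t : ℝ => iterInvDeriv X k α f (x * lieExp (t • X i))) 0

/-- `U_ε`, the set of products `exp (t₁ X₁) ⋯ exp (tₙ Xₙ)` (in this order) with `|tₖ| ≤ ε`. -/
def expBox {n : ℕ} (X : Fin n → GroupLieAlgebra I G) (ε : ℝ) : Set G :=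
  {u | ∃ t : Fin n → ℝ, (∀ k, -ε ≤ t k ∧ t k ≤ ε) ∧
    u = (List.ofFn fun k => lieExp (t k • X k)).prod}

end LieGroups

/-- The local oscillation `osc_U f (x) = sup_{u ∈ U} |f(x) - f(x u⁻¹)|`, with values in
`[0, ∞]`. -/
noncomputable def localOsc {G : Type*} [Group G] (U : Set G) (f : G → ℂ) (x : G) : ℝ≥0∞ :=
  ⨆ u ∈ U, ‖f x - f (x * u⁻¹)‖ₑ

/-!
The oscillation is estimated pointwise by local `L²` norms of derivatives, using only restrictions
of functions to one-parameter subgroups; no approximation by smooth functions is needed, and no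
derivative in a direction outside the given basis appears.

For a function `g` on the line that is differentiable everywhere, `‖g b - g a‖ ≤ ∫ ‖g'‖` holds in
`[0, ∞]` without integrability assumptions. Applied along one coordinate after the other in
`r ↦ x exp (r₁ Y₁) ⋯ exp (rₘ Yₘ)` and averaged over `[0, δ]`, it bounds `‖D^α f x‖` at *every* `x` by
an integral over the box `[0, δ]^m` of a common majorant `h` of the derivatives of order between `1`
and `n` (`enorm_iterInvDeriv_le_lintegral`).

For `x = y exp (t₁ X₁) ⋯ exp (tₙ Xₙ)` the difference `f x - f y` telescopes into integrals of
`D(X_j) f` over segments in the direction `X_j` of length at most `2ε`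
(`exists_enorm_sub_le_sum_lintegral`). In such a segment `D(X_j) f`, which has `n - 1` further
derivatives, is bounded by integrals of `h` over the remaining `n - 1` coordinates. Together this is
an `n`-dimensional integral of `h` in coordinates of the second kind for the reordered basis that
begins with `X_j`. The Cauchy-Schwarz inequality yields a factor `ε ^ (1 / 2)` and an integral of
`h ^ 2` in these coordinates, in which Lebesgue measure is dominated by Haar measure
(`exists_lintegral_expProd_le`, `exists_lintegral_invDeriv_le`). Hence `osc_ε f x` is at most
`A ε` times the `L²` norm of `h` over `xV`, with `V` compact and `A ε → 0`
(`exists_enorm_sub_mul_inv_le`).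

The square of this local norm integrates over `x` to `μ(V⁻¹) ‖h‖²`
(`lintegral_setLIntegral_translate`), which gives the norm inequality. The pointwise estimate is
also uniform in `x`, and `U_ε` is a neighbourhood of `1` (`expBox_mem_nhds_one`), so `f` is
continuous and its oscillation is lower semicontinuous, in particular measurable.

The comparison of measures rests on the strict derivative `(a, r) ↦ a + ∑ rᵢ Yᵢ` of
`(g, r) ↦ g exp (r₁ Y₁) ⋯ exp (rₙ Yₙ)` in the chart at `1`
(`hasStrictFDerivAt_extChartAt_mul_expProd`): it makes these maps antilipschitz near `0`, uniformly
for `g` near `1`, so that Hausdorff measure on the model space can be used without Jacobians.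
-/

/-! ### One-parameter subgroups -/

section OneParameterSubgroups

variable {E : Type*} [NormedAddCommGroup E] [NormedSpace ℝ E]
  {H : Type*} [TopologicalSpace H] {I : ModelWithCorners ℝ E H}
  {G : Type*} [TopologicalSpace G] [ChartedSpace H G] [Group G] [LieGroup I ∞ G]

variable [FiniteDimensional ℝ E]

theorem contMDiff_one_mulInvariantVectorField (v : GroupLieAlgebra I G) :
    ContMDiff I I.tangent 1
      (fun g : G => (mulInvariantVectorField v g : TangentBundle I G)) := by
  have : CompleteSpace E := FiniteDimensional.complete ℝ E
  have : LieGroup I (minSmoothness ℝ 3) G := LieGroup.of_le (n := ∞)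
    (by simp only [minSmoothness_of_isRCLikeNormedField]; exact WithTop.coe_le_coe.2 le_top)
  exact (contMDiff_mulInvariantVectorField v).of_le (by simp)

variable [I.Boundaryless] [T2Space G]

theorem isMIntegralCurve_mulInvariantVectorField_eq {v : GroupLieAlgebra I G} {γ γ' : ℝ → G}
    (hγ : IsMIntegralCurve γ (mulInvariantVectorField v))
    (hγ' : IsMIntegralCurve γ' (mulInvariantVectorField v)) (h : γ 0 = γ' 0) : γ = γ' := by
  have : CompleteSpace E := FiniteDimensional.complete ℝ E
  have : IsManifold I 1 G := IsManifold.of_le (n := ∞) (by simp)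
  exact isMIntegralCurve_Ioo_eq_of_contMDiff_boundaryless (t₀ := 0)
    (contMDiff_one_mulInvariantVectorField v) hγ hγ' h

/-- By uniqueness of integral curves, `t ↦ lieExp (t • v)` is the integral curve of the
left-invariant vector field of `v` through `1`. -/
theorem exists_isMIntegralCurve_lieExp (v : GroupLieAlgebra I G) :
    ∃ γ : ℝ → G, γ 0 = 1 ∧ IsMIntegralCurve γ (mulInvariantVectorField v) ∧
      ∀ t : ℝ, lieExp (t • v) = γ t := by
  obtain ⟨γ, h0, hγ⟩ := exists_isMIntegralCurve_mulInvariantVectorField v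
  refine ⟨γ, h0, hγ, fun t => ?_⟩
  have h1 := Classical.choose_spec (exists_isMIntegralCurve_mulInvariantVectorField (t • v))
  have h2 := hγ.comp_mul t
  have h3 : t • (mulInvariantVectorField v : ∀ g : G, TangentSpace I g) =
      mulInvariantVectorField (t • v) := by
    rw [mulInvariantVectorField_smul]
  rw [h3] at h2
  have := congrFun (isMIntegralCurve_mulInvariantVectorField_eq h1.2 h2 (by simp [h1.1, h0])) 1
  simp only [Function.comp_apply, one_mul] at this
  exact this

theorem isMIntegralCurve_lieExp_smul (v : GroupLieAlgebra I G) :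
    IsMIntegralCurve (fun t : ℝ => lieExp (t • v)) (mulInvariantVectorField v) := by
  obtain ⟨γ, -, hγ, h⟩ := exists_isMIntegralCurve_lieExp v
  rwa [funext h]

theorem lieExp_zero_smul (v : GroupLieAlgebra I G) : lieExp ((0 : ℝ) • v) = 1 := by
  obtain ⟨γ, h0, -, h⟩ := exists_isMIntegralCurve_lieExp v
  rw [h, h0]

theorem lieExp_add_smul (v : GroupLieAlgebra I G) (s t : ℝ) :
    lieExp ((s + t) • v) = lieExp (s • v) * lieExp (t • v) := by
  have h1 := (isMIntegralCurve_lieExp_smul v).comp_add s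
  have h2 : IsMIntegralCurve (fun t : ℝ => lieExp (s • v) * lieExp (t • v))
      (mulInvariantVectorField v) := by
    rw [isMIntegralCurve_iff_isMIntegralCurveOn]
    exact ((isMIntegralCurve_lieExp_smul v).isMIntegralCurveOn _).mul_left_mulInvariantVectorField _
  have := congrFun (isMIntegralCurve_mulInvariantVectorField_eq h1 h2
    (by simp [lieExp_zero_smul, -zero_smul])) t
  simpa [add_comm] using this

theorem continuous_lieExp_smul (v : GroupLieAlgebra I G) :
    Continuous fun t : ℝ => lieExp (t • v) :=
  (isMIntegralCurve_lieExp_smul v).continuous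

/-- The velocity of `t ↦ lieExp (t • v)` at `0`, read in the chart at `1`, is `v`. Strictness, needed
for the inverse function theorem, comes from continuity of the invariant vector field. -/
theorem hasStrictDerivAt_extChartAt_lieExp_smul (v : GroupLieAlgebra I G) :
    HasStrictDerivAt (fun t : ℝ => extChartAt I (1 : G) (lieExp (t • v))) (v : E) 0 := by
  have : IsManifold I 1 G := IsManifold.of_le (n := ∞) (by simp)
  have h1 := ((isMIntegralCurve_lieExp_smul v).isMIntegralCurveAt 0).eventually_hasDerivAt
  rw [lieExp_zero_smul] at h1
  have h2 : ContinuousAt (fun g : G =>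
      tangentCoordChange I g (1 : G) g (mulInvariantVectorField v g)) 1 :=
    ((Bundle.contMDiffAt_section _).1
      ((contMDiff_one_mulInvariantVectorField v).contMDiffAt (x := 1))).continuousAt
  have h3 : tangentCoordChange I (1 : G) (1 : G) (1 : G) (mulInvariantVectorField v 1) = (v : E) := by
    have h4 : mulInvariantVectorField v (1 : G) = v := by
      have h5 : ∀ f : G → G, f = id → ∀ w : E, (mfderiv I I f (1 : G) : E →L[ℝ] E) w = w := by
        rintro _ rfl w
        rw [mfderiv_id]
        rfl
      exact h5 _ (funext fun x => one_mul x) v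
    rw [h4]
    exact tangentCoordChange_self (I := I) (x := (1 : G)) (z := 1) (by simp)
  have h6 : ContinuousAt (fun t : ℝ => tangentCoordChange I (lieExp (t • v)) (1 : G)
      (lieExp (t • v)) (mulInvariantVectorField v (lieExp (t • v)))) 0 :=
    ContinuousAt.comp_of_eq h2 (continuous_lieExp_smul v).continuousAt (lieExp_zero_smul v)
  have h7 := hasStrictDerivAt_of_hasDerivAt_of_continuousAt h1 h6
  refine h7.congr_deriv ?_
  rw [lieExp_zero_smul, h3]

end OneParameterSubgroups

/-! ### Coordinates of the second kind in the chart at the identity -/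

section ChartOfProducts

variable {E : Type*} [NormedAddCommGroup E] [NormedSpace ℝ E]
  {H : Type*} [TopologicalSpace H] {I : ModelWithCorners ℝ E H}
  {G : Type*} [TopologicalSpace G] [ChartedSpace H G] [Group G] [LieGroup I ∞ G]

/-- In the chart at `1`, multiplication has the strict derivative `(a, b) ↦ a + b` at `(1, 1)`. -/
theorem hasStrictFDerivAt_extChartAt_mul [I.Boundaryless] :
    HasStrictFDerivAt (fun p : E × E => extChartAt I (1 : G)
        ((extChartAt I (1 : G)).symm p.1 * (extChartAt I (1 : G)).symm p.2))
      (ContinuousLinearMap.fst ℝ E E + ContinuousLinearMap.snd ℝ E E)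
      (extChartAt I (1 : G) 1, extChartAt I (1 : G) 1) := by
  set ψ := extChartAt I (1 : G) with hψ
  have : IsManifold I 1 G := IsManifold.of_le (n := ∞) (by simp)
  have hmem : ψ.target ∈ 𝓝 (ψ 1) := extChartAt_target_mem_nhds (I := I) (1 : G)
  have h1 : ψ.symm (ψ 1) = (1 : G) := extChartAt_to_inv (I := I) (1 : G)
  have hs : ContMDiffAt 𝓘(ℝ, E) I 1 ψ.symm (ψ 1) :=
    (contMDiffOn_extChartAt_symm (I := I) (n := 1) (1 : G)).contMDiffAt hmem
  have hmul : ContMDiffAt 𝓘(ℝ, E × E) I 1 (fun p : E × E => ψ.symm p.1 * ψ.symm p.2)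
      (ψ 1, ψ 1) := by
    have h2 : ContMDiffAt 𝓘(ℝ, E × E) I 1 (fun p : E × E => ψ.symm p.1) (ψ 1, ψ 1) :=
      ContMDiffAt.comp (I' := 𝓘(ℝ, E)) (ψ 1, ψ 1) (g := ψ.symm) (f := Prod.fst) hs
        contDiff_fst.contMDiff.contMDiffAt
    have h3 : ContMDiffAt 𝓘(ℝ, E × E) I 1 (fun p : E × E => ψ.symm p.2) (ψ 1, ψ 1) :=
      ContMDiffAt.comp (I' := 𝓘(ℝ, E)) (ψ 1, ψ 1) (g := ψ.symm) (f := Prod.snd) hs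
        contDiff_snd.contMDiff.contMDiffAt
    have : ContMDiffMul I 1 G := ContMDiffMul.of_le (n := ∞) (by simp)
    exact h2.mul h3
  have hd : ContDiffAt ℝ 1 (fun p : E × E => ψ (ψ.symm p.1 * ψ.symm p.2)) (ψ 1, ψ 1) := by
    refine ContMDiffAt.contDiffAt ?_
    exact ContMDiffAt.comp_of_eq (I' := I) (g := ψ)
      (contMDiffAt_extChartAt (I := I) (n := 1) (x := (1 : G))) hmul (by simp [h1])
  have hD := hd.hasStrictFDerivAt (by simp)
  refine hD.congr_fderiv ?_
  symm
  set D := fderiv ℝ (fun p : E × E => ψ (ψ.symm p.1 * ψ.symm p.2)) (ψ 1, ψ 1)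
  -- the partial maps `a ↦ a * 1` and `a ↦ 1 * a` are the identity near `1`
  have hinl : D.comp (ContinuousLinearMap.inl ℝ E E) = ContinuousLinearMap.id ℝ E := by
    have h4 : HasFDerivAt (fun a : E => (a, ψ 1)) (ContinuousLinearMap.inl ℝ E E) (ψ 1) :=
      hasFDerivAt_prodMk_left _ _
    refine (HasFDerivAt.comp (f := fun a : E => (a, ψ 1)) (ψ 1) hD.hasFDerivAt h4).unique ((hasFDerivAt_id _).congr_of_eventuallyEq ?_)
    filter_upwards [hmem] with a ha
    simp [h1, ψ.right_inv ha]
  have hinr : D.comp (ContinuousLinearMap.inr ℝ E E) = ContinuousLinearMap.id ℝ E := by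
    have h4 : HasFDerivAt (fun a : E => (ψ 1, a)) (ContinuousLinearMap.inr ℝ E E) (ψ 1) :=
      hasFDerivAt_prodMk_right _ _
    refine (HasFDerivAt.comp (f := fun a : E => (ψ 1, a)) (ψ 1) hD.hasFDerivAt h4).unique ((hasFDerivAt_id _).congr_of_eventuallyEq ?_)
    filter_upwards [hmem] with a ha
    simp [h1, ψ.right_inv ha]
  ext a
  · simpa using (DFunLike.congr_fun hinl a).symm
  · simpa using (DFunLike.congr_fun hinr a).symm

/-- The linear map `r ↦ r₁ Y₁ + ⋯ + rₘ Yₘ`. -/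
noncomputable def linCombCLM {m : ℕ} (Y : Fin m → E) : (Fin m → ℝ) →L[ℝ] E :=
  ∑ i, (ContinuousLinearMap.proj (R := ℝ) (φ := fun _ : Fin m => ℝ) i).smulRight (Y i)

theorem linCombCLM_apply {m : ℕ} (Y : Fin m → E) (r : Fin m → ℝ) :
    linCombCLM Y r = ∑ i, r i • Y i := by
  simp [linCombCLM]

theorem linCombCLM_succ {m : ℕ} (Y : Fin (m + 1) → E) (r : Fin (m + 1) → ℝ) :
    linCombCLM Y r = r 0 • Y 0 + linCombCLM (fun i => Y i.succ) (fun i => r i.succ) := by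
  simp [linCombCLM_apply, Fin.sum_univ_succ]

variable [FiniteDimensional ℝ E] [I.Boundaryless] [T2Space G]

/-- The product `exp (r₁ Y₁) ⋯ exp (rₘ Yₘ)`, i.e. the coordinates of the second kind on `G` when
`Y` is a basis of the Lie algebra. -/
noncomputable def expProd {m : ℕ} (Y : Fin m → GroupLieAlgebra I G) (r : Fin m → ℝ) : G :=
  (List.ofFn fun k => lieExp (r k • Y k)).prod

theorem expProd_fin_zero (Y : Fin 0 → GroupLieAlgebra I G) (r : Fin 0 → ℝ) :
    expProd Y r = 1 := by
  simp [expProd]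

theorem expProd_succ {m : ℕ} (Y : Fin (m + 1) → GroupLieAlgebra I G) (r : Fin (m + 1) → ℝ) :
    expProd Y r = lieExp (r 0 • Y 0) * expProd (fun i => Y i.succ) (fun i => r i.succ) := by
  simp [expProd, List.ofFn_succ]

theorem continuous_expProd {m : ℕ} (Y : Fin m → GroupLieAlgebra I G) :
    Continuous (expProd Y) := by
  have : IsTopologicalGroup G := topologicalGroup_of_lieGroup I ∞
  induction m with
  | zero => simpa [funext (expProd_fin_zero Y)] using continuous_const
  | succ m ih =>
    simp only [funext (expProd_succ Y)]
    exact ((continuous_lieExp_smul (Y 0)).comp (continuous_apply 0)).mul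
      ((ih _).comp (by fun_prop))

theorem expProd_zero {m : ℕ} (Y : Fin m → GroupLieAlgebra I G) : expProd Y 0 = 1 := by
  induction m with
  | zero => exact expProd_fin_zero Y 0
  | succ m ih =>
    rw [expProd_succ, Pi.zero_apply, lieExp_zero_smul, one_mul]
    exact ih _

/-- In the chart at `1`, the map `(g, r) ↦ g exp (r₁ Y₁) ⋯ exp (rₘ Yₘ)` has the strict derivative
`(a, r) ↦ a + ∑ rᵢ Yᵢ` at `(1, 0)`. -/
theorem hasStrictFDerivAt_extChartAt_mul_expProd {m : ℕ} (Y : Fin m → GroupLieAlgebra I G) :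
    HasStrictFDerivAt (fun p : E × (Fin m → ℝ) => extChartAt I (1 : G)
        ((extChartAt I (1 : G)).symm p.1 * expProd Y p.2))
      (ContinuousLinearMap.fst ℝ E (Fin m → ℝ) +
        (linCombCLM (E := E) Y).comp (ContinuousLinearMap.snd ℝ E (Fin m → ℝ)))
      (extChartAt I (1 : G) 1, 0) := by
  have : IsTopologicalGroup G := topologicalGroup_of_lieGroup I ∞
  set ψ := extChartAt I (1 : G) with hψ
  have hmem : ψ.target ∈ 𝓝 (ψ 1) := extChartAt_target_mem_nhds (I := I) (1 : G)
  have hsrc : ψ.source ∈ 𝓝 (1 : G) := extChartAt_source_mem_nhds (I := I) (1 : G)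
  have h1 : ψ.symm (ψ 1) = (1 : G) := extChartAt_to_inv (I := I) (1 : G)
  have hcs : ContinuousAt ψ.symm (ψ 1) := continuousAt_extChartAt_symm (I := I) (1 : G)
  induction m with
  | zero =>
    refine HasStrictFDerivAt.congr_of_eventuallyEq (f := Prod.fst) ?_ ?_
    · refine hasStrictFDerivAt_fst.congr_fderiv ?_
      ext <;> simp [linCombCLM]
    · filter_upwards [(continuous_fst.tendsto ((ψ 1, 0) : E × (Fin 0 → ℝ))).eventually hmem]
        with p hp
      simp [expProd_fin_zero, ψ.right_inv hp]
  | succ m ih =>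
    -- `g * (exp (r₀ Y₀) * P) = (g * exp (r₀ Y₀)) * P`, and the inner factor is again near `1`
    have hc : HasStrictFDerivAt (fun p : E × (Fin (m + 1) → ℝ) => ψ (lieExp (p.2 0 • Y 0)))
        (((ContinuousLinearMap.proj (R := ℝ) (φ := fun _ : Fin (m + 1) => ℝ) 0).smulRight
          (M₂ := E) (Y 0)).comp (ContinuousLinearMap.snd ℝ E (Fin (m + 1) → ℝ))) (ψ 1, 0) := by
      have h2 : HasStrictFDerivAt (fun p : E × (Fin (m + 1) → ℝ) => p.2 0)
          ((ContinuousLinearMap.proj (R := ℝ) (φ := fun _ : Fin (m + 1) => ℝ) 0).comp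
            (ContinuousLinearMap.snd ℝ E (Fin (m + 1) → ℝ))) (ψ 1, 0) :=
        ((ContinuousLinearMap.proj (R := ℝ) (φ := fun _ : Fin (m + 1) => ℝ) 0).comp
            (ContinuousLinearMap.snd ℝ E (Fin (m + 1) → ℝ))).hasStrictFDerivAt
      have h3 := (hasStrictDerivAt_extChartAt_lieExp_smul (Y 0)).hasStrictFDerivAt
      have h4 := HasStrictFDerivAt.comp (x := ((ψ 1, 0) : E × (Fin (m + 1) → ℝ)))
        (g := fun t : ℝ => ψ (lieExp (t • Y 0))) (f := fun p => p.2 0) (by exact h3) h2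
      exact h4.congr_fderiv (ContinuousLinearMap.ext fun p => rfl)
    have hm : HasStrictFDerivAt (fun p : E × (Fin (m + 1) → ℝ) =>
        ψ (ψ.symm p.1 * ψ.symm (ψ (lieExp (p.2 0 • Y 0))))) _ (ψ 1, 0) :=
      HasStrictFDerivAt.comp (x := ((ψ 1, 0) : E × (Fin (m + 1) → ℝ)))
        (g := fun p : E × E => ψ (ψ.symm p.1 * ψ.symm p.2))
        (f := fun p => (p.1, ψ (lieExp (p.2 0 • Y 0))))
        (by
          have h5 : ψ (lieExp ((0 : ℝ) • Y 0)) = ψ 1 := by rw [lieExp_zero_smul]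
          change HasStrictFDerivAt _ _ (ψ 1, ψ (lieExp ((0 : ℝ) • Y 0)))
          rw [h5]
          exact hasStrictFDerivAt_extChartAt_mul (I := I) (G := G))
        (hasStrictFDerivAt_fst.prodMk hc)
    have ht : HasStrictFDerivAt (fun p : E × (Fin (m + 1) → ℝ) => fun i : Fin m => p.2 i.succ)
        ((ContinuousLinearMap.pi fun i : Fin m =>
          (ContinuousLinearMap.proj (R := ℝ) (φ := fun _ : Fin (m + 1) => ℝ) i.succ)).comp
            (ContinuousLinearMap.snd ℝ E (Fin (m + 1) → ℝ))) (ψ 1, 0) :=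
      ((ContinuousLinearMap.pi fun i : Fin m =>
          (ContinuousLinearMap.proj (R := ℝ) (φ := fun _ : Fin (m + 1) => ℝ) i.succ)).comp
            (ContinuousLinearMap.snd ℝ E (Fin (m + 1) → ℝ))).hasStrictFDerivAt
    have hF := HasStrictFDerivAt.comp (x := ((ψ 1, 0) : E × (Fin (m + 1) → ℝ)))
      (g := fun p : E × (Fin m → ℝ) => ψ (ψ.symm p.1 * expProd (fun i => Y i.succ) p.2))
      (f := fun p => (ψ (ψ.symm p.1 * ψ.symm (ψ (lieExp (p.2 0 • Y 0)))), fun i => p.2 i.succ))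
      (by
        simp only [Pi.zero_apply, lieExp_zero_smul, h1, mul_one]
        exact ih fun i => Y i.succ) (hm.prodMk ht)
    refine HasStrictFDerivAt.congr_of_eventuallyEq (hF.congr_fderiv ?_) ?_
    · exact ContinuousLinearMap.ext fun p => (add_assoc (G := E) _ _ _).trans
        (congrArg (p.1 + ·) (linCombCLM_succ (E := E) Y p.2).symm)
    · have hz1 : ContinuousAt (fun p : E × (Fin (m + 1) → ℝ) => lieExp (p.2 0 • Y 0)) (ψ 1, 0) :=
        ((continuous_lieExp_smul (Y 0)).comp
          ((continuous_apply 0).comp continuous_snd)).continuousAt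
      have hz : ContinuousAt (fun p : E × (Fin (m + 1) → ℝ) =>
          ψ.symm p.1 * lieExp (p.2 0 • Y 0)) (ψ 1, 0) :=
        (ContinuousAt.comp_of_eq hcs continuousAt_fst rfl).mul hz1
      have e1 := hz1.eventually_mem (s := ψ.source)
        (by simpa [lieExp_zero_smul, -zero_smul] using hsrc)
      have e2 := hz.eventually_mem (s := ψ.source)
        (by simpa [lieExp_zero_smul, h1, -zero_smul] using hsrc)
      filter_upwards [e1, e2] with p hp1 hp2
      rw [ψ.left_inv hp1, ψ.left_inv hp2, expProd_succ, mul_assoc]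

end ChartOfProducts

/-! ### Local comparison of Lebesgue measure and Haar measure -/

section LocalCoordinates

variable {E : Type*} [NormedAddCommGroup E] [NormedSpace ℝ E] [FiniteDimensional ℝ E]
  {H : Type*} [TopologicalSpace H] {I : ModelWithCorners ℝ E H} [I.Boundaryless]
  {G : Type*} [TopologicalSpace G] [ChartedSpace H G] [Group G] [LieGroup I ∞ G] [T2Space G]

theorem expBox_mem_nhds_one {n : ℕ} (X : Module.Basis (Fin n) ℝ (GroupLieAlgebra I G)) {ε : ℝ}
    (hε : 0 < ε) : expBox X ε ∈ 𝓝 (1 : G) := by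
  set ψ := extChartAt I (1 : G) with hψ
  have hsrc : ψ.source ∈ 𝓝 (1 : G) := extChartAt_source_mem_nhds (I := I) (1 : G)
  have h1 : ψ.symm (ψ 1) = (1 : G) := extChartAt_to_inv (I := I) (1 : G)
  have hd : HasStrictFDerivAt (fun r : Fin n → ℝ => ψ (expProd X r)) (linCombCLM (E := E) X) 0 := by
    have h2 : HasStrictFDerivAt (fun r : Fin n → ℝ => ((ψ 1, r) : E × (Fin n → ℝ)))
        ((0 : (Fin n → ℝ) →L[ℝ] E).prod (ContinuousLinearMap.id ℝ (Fin n → ℝ))) 0 :=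
      (hasStrictFDerivAt_const _ _).prodMk (hasStrictFDerivAt_id _)
    have h3 := HasStrictFDerivAt.comp (x := (0 : Fin n → ℝ))
      (f := fun r : Fin n → ℝ => ((ψ 1, r) : E × (Fin n → ℝ)))
      (hasStrictFDerivAt_extChartAt_mul_expProd X) h2
    rw [← hψ] at h3
    simp only [h1, one_mul] at h3
    exact h3.congr_fderiv (by ext; simp)
  have hsurj : (linCombCLM (E := E) X).range = ⊤ := by
    rw [LinearMap.range_eq_top]
    intro v
    refine ⟨X.equivFun v, ?_⟩
    exact (linCombCLM_apply (E := E) _ _).trans (X.sum_equivFun v)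
  have : CompleteSpace E := FiniteDimensional.complete ℝ E
  have hmap := hd.map_nhds_eq_of_surj hsurj
  set B : Set (Fin n → ℝ) := Set.Icc (fun _ => -ε) (fun _ => ε) ∩ expProd X ⁻¹' ψ.source
  have hB : B ∈ 𝓝 (0 : Fin n → ℝ) := by
    refine inter_mem ?_ ((continuous_expProd X).continuousAt.preimage_mem_nhds ?_)
    · rw [← Set.pi_univ_Icc]
      exact set_pi_mem_nhds Set.finite_univ fun i _ => Icc_mem_nhds (by simpa) (by simpa)
    · rwa [expProd_zero]
  have h4 := image_mem_map (m := fun r => ψ (expProd X r)) hB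
  rw [hmap, expProd_zero] at h4
  filter_upwards [(continuousAt_extChartAt (I := I) (1 : G)).preimage_mem_nhds h4, hsrc]
    with g hg hgs
  obtain ⟨r, ⟨hr, hrs⟩, hrg⟩ := hg
  refine ⟨r, fun k => ⟨hr.1 k, hr.2 k⟩, ?_⟩
  exact (ψ.injOn hrs hgs hrg).symm

/-- For `g` near `1` the maps `r ↦ g exp (r₁ Y₁) ⋯ exp (rₘ Yₘ)`, read in the chart at `1`, are
antilipschitz on a common neighbourhood of `0`, with a common constant. -/
theorem exists_antilipschitz_mul_expProd {n : ℕ}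
    (Y : Module.Basis (Fin n) ℝ (GroupLieAlgebra I G)) :
    ∃ K : ℝ≥0, ∀ᶠ p : G × (Fin n → ℝ) × (Fin n → ℝ) in 𝓝 (1, 0, 0),
      dist p.2.1 p.2.2 ≤ K * dist (extChartAt I (1 : G) (p.1 * expProd Y p.2.1))
        (extChartAt I (1 : G) (p.1 * expProd Y p.2.2)) := by
  set ψ := extChartAt I (1 : G) with hψ
  have hsrc : ψ.source ∈ 𝓝 (1 : G) := extChartAt_source_mem_nhds (I := I) (1 : G)
  have hker : (linCombCLM (E := E) Y).ker = ⊥ := by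
    rw [LinearMap.ker_eq_bot']
    intro r hr
    have h1 : Y.equivFun.symm r = 0 := by
      rw [Y.equivFun_symm_apply]
      exact (linCombCLM_apply (E := E) Y r).symm.trans hr
    exact Y.equivFun.symm.map_eq_zero_iff.1 h1
  -- `2K`, since an error term of half the size of the linear part is absorbed below
  obtain ⟨K, hK, hanti⟩ := LinearMap.exists_antilipschitzWith
    (linCombCLM (E := E) Y : (Fin n → ℝ) →ₗ[ℝ] E) hker
  refine ⟨2 * K, ?_⟩
  have ho := (hasStrictFDerivAt_extChartAt_mul_expProd Y).isLittleO.def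
    (c := (2 * (K : ℝ))⁻¹) (by positivity)
  have hc : ContinuousAt (fun p : G × (Fin n → ℝ) × (Fin n → ℝ) =>
      (((ψ p.1, p.2.1), (ψ p.1, p.2.2)) : (E × (Fin n → ℝ)) × (E × (Fin n → ℝ)))) (1, 0, 0) := by
    have : ContinuousAt (fun p : G × (Fin n → ℝ) × (Fin n → ℝ) => ψ p.1) (1, 0, 0) :=
      ContinuousAt.comp_of_eq (continuousAt_extChartAt (I := I) (1 : G)) continuousAt_fst rfl
    exact (this.prodMk (by fun_prop)).prodMk (this.prodMk (by fun_prop))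
  have hs : ∀ᶠ p : G × (Fin n → ℝ) × (Fin n → ℝ) in 𝓝 (1, 0, 0), p.1 ∈ ψ.source :=
    continuousAt_fst.eventually_mem hsrc
  filter_upwards [hc.eventually ho, hs] with p hp hps
  obtain ⟨g, r, r'⟩ := p
  dsimp only at hp hps ⊢
  rw [← hψ, ψ.left_inv hps] at hp
  have h2 : ((ψ g, r) - (ψ g, r') : E × (Fin n → ℝ)) = (0, r - r') := by simp
  rw [h2] at hp
  have h3 : ‖((0 : E), r - r')‖ = dist r r' := by simp [dist_eq_norm]
  rw [h3] at hp
  have h4 := hanti.le_mul_dist r r'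
  have h5 : dist (linCombCLM (E := E) Y r) (linCombCLM (E := E) Y r') ≤
      dist (ψ (g * expProd Y r)) (ψ (g * expProd Y r')) + (2 * (K : ℝ))⁻¹ * dist r r' := by
    rw [dist_eq_norm, dist_eq_norm, ← map_sub]
    have h6 : ‖linCombCLM (E := E) Y (r - r')‖ ≤ ‖ψ (g * expProd Y r) - ψ (g * expProd Y r')‖ +
      ‖ψ (g * expProd Y r) - ψ (g * expProd Y r') - linCombCLM (E := E) Y (r - r')‖ := by
      exact norm_le_norm_add_norm_sub _ _
    refine h6.trans (add_le_add le_rfl (le_trans (le_of_eq ?_) hp))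
    simp
  have hK' : (0 : ℝ) < K := hK
  have h7 : (K : ℝ) * ((2 * (K : ℝ))⁻¹ * dist r r') = dist r r' / 2 := by field_simp
  have h8 := h4.trans (mul_le_mul_of_nonneg_left h5 hK'.le)
  rw [mul_add, h7] at h8
  push_cast
  linarith

end LocalCoordinates

section MeasureEstimates

open scoped Pointwise

/-- A map that shrinks distances on `T` by at most the factor `K` shrinks volumes on `T` by at most
the factor `Kⁿ`. -/
theorem volume_le_hausdorffMeasure_image {n : ℕ} {E : Type*} [MetricSpace E]
    [MeasurableSpace E] [BorelSpace E] {K : ℝ≥0} {f : (Fin n → ℝ) → E} {T : Set (Fin n → ℝ)}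
    (hf : ∀ x ∈ T, ∀ y ∈ T, dist x y ≤ K * dist (f x) (f y)) :
    volume T ≤ (K : ℝ≥0∞) ^ n * μH[n] (f '' T) := by
  have hinj : Set.InjOn f T := fun x hx y hy hxy => by
    simpa [hxy] using hf x hx y hy
  have hL : LipschitzOnWith K (Function.invFunOn f T) (f '' T) := by
    refine LipschitzOnWith.of_dist_le_mul ?_
    rintro _ ⟨x, hx, rfl⟩ _ ⟨y, hy, rfl⟩
    rw [hinj.leftInvOn_invFunOn hx, hinj.leftInvOn_invFunOn hy]
    exact hf x hx y hy
  have h := hL.hausdorffMeasure_image_le (d := n) (by positivity)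
  rw [hinj.leftInvOn_invFunOn.image_image, ENNReal.rpow_natCast] at h
  have hv : (μH[n] : Measure (Fin n → ℝ)) = volume := by
    simpa using hausdorffMeasure_pi_real (ι := Fin n)
  rwa [hv] at h

variable {G : Type*} [TopologicalSpace G] [Group G] [IsTopologicalGroup G] [LocallyCompactSpace G]
  [SecondCountableTopology G] [MeasurableSpace G] [BorelSpace G]

/-- Right translations by the elements of a compact set distort a Haar measure by a bounded
factor. -/
theorem exists_lintegral_mul_right_le (μ : Measure G) [μ.IsHaarMeasure] {S : Set G}
    (hS : IsCompact S) :
    ∃ C : ℝ≥0∞, C ≠ ⊤ ∧ ∀ y ∈ S, ∀ h : G → ℝ≥0∞, Measurable h →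
      ∫⁻ x, h (x * y) ∂μ ≤ C * ∫⁻ x, h x ∂μ := by
  obtain ⟨A, hAc, hA⟩ := exists_compact_mem_nhds (1 : G)
  have hA0 : μ A ≠ 0 := (Measure.measure_pos_of_mem_nhds μ hA).ne'
  have hAt : μ A ≠ ⊤ := hAc.measure_lt_top.ne
  refine ⟨μ (A * S⁻¹) / μ A, ENNReal.div_ne_top (hAc.mul hS.inv).measure_lt_top.ne hA0,
    fun y hy h hh => ?_⟩
  have hmeas : Measurable fun x : G => x * y := measurable_mul_const y
  have hfin : IsFiniteMeasureOnCompacts (μ.map (· * y)) :=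
    Measure.IsFiniteMeasureOnCompacts.map μ (Homeomorph.mulRight y)
  have heq := Measure.isMulLeftInvariant_eq_smul (μ.map (· * y)) μ
  set c := (μ.map (· * y)).haarScalarFactor μ
  have hc : (c : ℝ≥0∞) ≤ μ (A * S⁻¹) / μ A := by
    rw [ENNReal.le_div_iff_mul_le (Or.inl hA0) (Or.inl hAt)]
    have h1 : (μ.map (· * y)) A = c * μ A := by rw [heq]; rfl
    rw [← h1]
    refine ((Homeomorph.mulRight y).measurableEmbedding.map_apply μ A).trans_le
      (measure_mono fun g hg => ?_)
    exact ⟨g * y, hg, y⁻¹, Set.inv_mem_inv.2 hy, mul_inv_cancel_right g y⟩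
  rw [← lintegral_map hh hmeas, heq]
  rw [lintegral_smul_measure]
  exact mul_le_mul_left hc _

end MeasureEstimates

section CoordinatesOfSecondKind

variable {E : Type*} [NormedAddCommGroup E] [NormedSpace ℝ E] [FiniteDimensional ℝ E]
  {H : Type*} [TopologicalSpace H] {I : ModelWithCorners ℝ E H} [I.Boundaryless]
  {G : Type*} [TopologicalSpace G] [ChartedSpace H G] [Group G] [LieGroup I ∞ G] [T2Space G]
  [SecondCountableTopology G] [MeasurableSpace G] [BorelSpace G]

/-- In coordinates of the second kind near `1`, Lebesgue measure is at most a constant times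
Haar measure. For each `g` near `1`, the substitution `r ↦ g⁻¹ exp (r₁ Y₁) ⋯ exp (rₙ Yₙ)` bounds the
left-hand side by an integral of `h (g * ·)` against a fixed finite measure of compact support, and
the average over `g` of the latter is controlled by the Haar integral of `h`. -/
theorem exists_lintegral_expProd_le (μ : Measure G) [μ.IsHaarMeasure] {n : ℕ}
    (Y : Module.Basis (Fin n) ℝ (GroupLieAlgebra I G)) :
    ∃ δ : ℝ, 0 < δ ∧ δ ≤ 1 ∧ ∃ C : ℝ≥0∞, C ≠ ⊤ ∧ ∀ h : G → ℝ≥0∞, Measurable h →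
      ∫⁻ r in Set.univ.pi fun _ : Fin n => Set.Icc 0 δ, h (expProd Y r) ≤ C * ∫⁻ x, h x ∂μ := by
  have : IsTopologicalGroup G := topologicalGroup_of_lieGroup I ∞
  have : LocallyCompactSpace G := Manifold.locallyCompact_of_finiteDimensional I
  have : ProperSpace E := FiniteDimensional.proper ℝ E
  borelize E
  set ψ := extChartAt I (1 : G) with hψ
  have hsrc : ψ.source ∈ 𝓝 (1 : G) := extChartAt_source_mem_nhds (I := I) (1 : G)
  have htar : ψ.target ∈ 𝓝 (ψ 1) := extChartAt_target_mem_nhds (I := I) (1 : G)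
  obtain ⟨ρ, hρ, hB⟩ := Metric.nhds_basis_closedBall.mem_iff.1 htar
  set B := Metric.closedBall (ψ 1) ρ
  have hBc : IsCompact B := isCompact_closedBall _ _
  have hcont : ContinuousOn ψ.symm B := (continuousOn_extChartAt_symm (I := I) (1 : G)).mono hB
  have hSc : IsCompact (ψ.symm '' B) := hBc.image_of_continuousOn hcont
  -- the normalization of Lebesgue measure on `E` for which it is comparable, via an
  -- antilipschitz map, to Lebesgue measure on `Fin n → ℝ`
  have hdim : Module.finrank ℝ E = n := by
    exact (Module.finrank_eq_card_basis Y).trans (Fintype.card_fin n)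
  have hHaar : (μH[n] : Measure E).IsAddHaarMeasure := by
    rw [← hdim]
    infer_instance
  have hae : AEMeasurable ψ.symm ((μH[n] : Measure E).restrict B) :=
    hcont.aemeasurable hBc.measurableSet
  set ν : Measure G := ((μH[n] : Measure E).restrict B).map ψ.symm with hν
  have hfinB : IsFiniteMeasure ((μH[n] : Measure E).restrict B) :=
    ⟨by simpa using hBc.measure_lt_top⟩
  have hνfin : IsFiniteMeasure ν := by infer_instance
  have hνS : ∀ᵐ y ∂ν, y ∈ ψ.symm '' B := by
    refine (ae_map_iff hae hSc.measurableSet).2 ?_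
    filter_upwards [ae_restrict_mem hBc.measurableSet] with e he using Set.mem_image_of_mem _ he
  obtain ⟨C₁, hC₁, hright⟩ := exists_lintegral_mul_right_le μ hSc
  obtain ⟨K, hK⟩ := exists_antilipschitz_mul_expProd Y
  -- a neighbourhood of `1` and a box on which everything takes place inside the chart
  have hmul : ContinuousAt (fun p : G × (Fin n → ℝ) × (Fin n → ℝ) => p.1 * expProd Y p.2.1)
      (1, 0, 0) :=
    (continuous_fst.mul ((continuous_expProd Y).comp (by fun_prop))).continuousAt
  have hmul1 : (1 : G) * expProd Y 0 = 1 := by rw [expProd_zero, one_mul]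
  have hin : ∀ᶠ p : G × (Fin n → ℝ) × (Fin n → ℝ) in 𝓝 (1, 0, 0),
      p.1 * expProd Y p.2.1 ∈ ψ.source ∩ ψ ⁻¹' B := by
    refine hmul.eventually_mem ?_
    rw [hmul1]
    exact inter_mem hsrc ((continuousAt_extChartAt (I := I) (1 : G)).preimage_mem_nhds
      (Metric.closedBall_mem_nhds _ hρ))
  obtain ⟨W, hW, V, hV, hWV⟩ := mem_nhds_prod_iff.1 (hK.and hin)
  rw [nhds_prod_eq] at hV
  obtain ⟨V', hV', hVV⟩ := mem_prod_same_iff.1 hV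
  obtain ⟨δ₀, hδ₀, hball⟩ := Metric.nhds_basis_closedBall.mem_iff.1 hV'
  set δ := min δ₀ 1
  have hδ : 0 < δ := by positivity
  set Q : Set (Fin n → ℝ) := Set.univ.pi fun _ : Fin n => Set.Icc 0 δ
  have hQm : MeasurableSet Q := MeasurableSet.univ_pi fun _ => measurableSet_Icc
  have hQV : Q ⊆ V' := fun r hr => hball <| by
    rw [mem_closedBall_zero_iff, pi_norm_le_iff_of_nonneg hδ₀.le]
    intro i
    have := hr i (Set.mem_univ i)
    rw [Real.norm_of_nonneg this.1]
    exact this.2.trans (min_le_left _ _)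
  have hQ : ∀ g ∈ W, ∀ r ∈ Q, ∀ r' ∈ Q,
      dist r r' ≤ K * dist (ψ (g * expProd Y r)) (ψ (g * expProd Y r')) ∧
        g * expProd Y r ∈ ψ.source ∩ ψ ⁻¹' B := fun g hg r hr r' hr' =>
    hWV (Set.mk_mem_prod hg (hVV (Set.mk_mem_prod (hQV hr) (hQV hr'))))
  have hΦ : Measurable (expProd Y) := (continuous_expProd Y).measurable
  -- comparison for a single translate
  have hstep : ∀ g : G, g⁻¹ ∈ W → ∀ h : G → ℝ≥0∞, Measurable h →
      ∫⁻ r in Q, h (expProd Y r) ≤ (K : ℝ≥0∞) ^ n * ∫⁻ y, h (g * y) ∂ν := by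
    intro g hg h hh
    have hle : (volume.restrict Q).map (expProd Y) ≤ ((K : ℝ≥0∞) ^ n) • ν.map (g * ·) := by
      refine Measure.le_iff.2 fun s hs => ?_
      have hgs : MeasurableSet ((g * ·) ⁻¹' s) := measurable_const_mul g hs
      rw [Measure.map_apply hΦ hs, Measure.restrict_apply (hΦ hs), Measure.smul_apply,
        Measure.map_apply (measurable_const_mul g) hs, hν,
        Measure.map_apply_of_aemeasurable hae hgs, Measure.restrict_apply' hBc.measurableSet,
        smul_eq_mul]
      refine (volume_le_hausdorffMeasure_image (f := fun r => ψ (g⁻¹ * expProd Y r))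
        fun r hr r' hr' => (hQ _ hg r hr.2 r' hr'.2).1).trans ?_
      gcongr
      rintro _ ⟨r, ⟨hrs, hrQ⟩, rfl⟩
      have h1 := (hQ _ hg r hrQ r hrQ).2
      refine ⟨?_, h1.2⟩
      change g * ψ.symm (ψ (g⁻¹ * expProd Y r)) ∈ s
      rw [ψ.left_inv h1.1, mul_inv_cancel_left]
      exact hrs
    calc ∫⁻ r in Q, h (expProd Y r) = ∫⁻ y, h y ∂(volume.restrict Q).map (expProd Y) :=
          (lintegral_map hh hΦ).symm
      _ ≤ ∫⁻ y, h y ∂(((K : ℝ≥0∞) ^ n) • ν.map (g * ·)) := lintegral_mono' hle le_rfl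
      _ = (K : ℝ≥0∞) ^ n * ∫⁻ y, h (g * y) ∂ν := by
          rw [lintegral_smul_measure, lintegral_map hh (measurable_const_mul g), smul_eq_mul]
  -- averaging over the translates
  obtain ⟨A', hA'1, hA'o, hA't⟩ := μ.exists_isOpen_measure_lt_top (1 : G)
  set A := A' ∩ interior W⁻¹
  have hAo : IsOpen A := hA'o.inter isOpen_interior
  have hW' : W⁻¹ ∈ 𝓝 (1 : G) := inv_mem_nhds_one G hW
  have hA1 : (1 : G) ∈ A := ⟨hA'1, mem_interior_iff_mem_nhds.2 hW'⟩
  have hA0 : μ A ≠ 0 := (hAo.measure_pos μ ⟨1, hA1⟩).ne'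
  have hAt : μ A ≠ ⊤ := ((measure_mono Set.inter_subset_left).trans_lt hA't).ne
  refine ⟨δ, hδ, min_le_right _ _, (K : ℝ≥0∞) ^ n * (C₁ * ν Set.univ) / μ A,
    ENNReal.div_ne_top (by finiteness) hA0, fun h hh => ?_⟩
  rw [← ENNReal.mul_div_right_comm, ENNReal.le_div_iff_mul_le (Or.inl hA0) (Or.inl hAt)]
  have hh2 : Measurable fun p : G × G => h (p.1 * p.2) := hh.comp measurable_mul
  calc (∫⁻ r in Q, h (expProd Y r)) * μ A
      = ∫⁻ _ in A, (∫⁻ r in Q, h (expProd Y r)) ∂μ := by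
        rw [lintegral_const, Measure.restrict_apply_univ]
    _ ≤ ∫⁻ g in A, (K : ℝ≥0∞) ^ n * ∫⁻ y, h (g * y) ∂ν ∂μ :=
        setLIntegral_mono' hAo.measurableSet fun g hg =>
          hstep g (Set.mem_inv.1 (interior_subset (s := W⁻¹) hg.2)) h hh
    _ ≤ ∫⁻ g, (K : ℝ≥0∞) ^ n * ∫⁻ y, h (g * y) ∂ν ∂μ := setLIntegral_le_lintegral _ _
    _ = (K : ℝ≥0∞) ^ n * ∫⁻ y, ∫⁻ g, h (g * y) ∂μ ∂ν := by
        rw [lintegral_const_mul' _ _ (by finiteness), lintegral_lintegral_swap hh2.aemeasurable]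
    _ ≤ (K : ℝ≥0∞) ^ n * ∫⁻ _, C₁ * ∫⁻ x, h x ∂μ ∂ν := by
        refine mul_le_mul' le_rfl (lintegral_mono_ae ?_)
        filter_upwards [hνS] with y hy using hright y hy h hh
    _ = (K : ℝ≥0∞) ^ n * (C₁ * ν Set.univ) * ∫⁻ x, h x ∂μ := by
        rw [lintegral_const]
        ring

end CoordinatesOfSecondKind

/-! ### Pointwise bounds by integrals of derivatives -/

section OneVariable

/-- The fundamental theorem of calculus as an inequality in `[0, ∞]`, where no integrability of the
derivative is needed. -/
theorem enorm_sub_le_lintegral_deriv {g g' : ℝ → ℂ} (hg : ∀ t, HasDerivAt g (g' t) t) (a b : ℝ) :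
    ‖g b - g a‖ₑ ≤ ∫⁻ s in Set.uIcc a b, ‖g' s‖ₑ := by
  by_cases hfin : ∫⁻ s in Set.uIcc a b, ‖g' s‖ₑ = ⊤
  · rw [hfin]; exact le_top
  have hmeas : Measurable g' := by
    rw [show g' = deriv g from funext fun t => (hg t).deriv.symm]
    exact measurable_deriv g
  have hint : IntegrableOn g' (Set.uIcc a b) :=
    ⟨hmeas.aestronglyMeasurable, lt_top_iff_ne_top.2 hfin⟩
  have hint' : IntervalIntegrable g' volume a b := by
    rw [intervalIntegrable_iff]
    exact hint.mono_set Set.uIoc_subset_uIcc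
  rw [← intervalIntegral.integral_eq_sub_of_hasDerivAt (fun t _ => hg t) hint']
  calc ‖∫ s in a..b, g' s‖ₑ = ‖∫ s in Set.uIoc a b, g' s‖ₑ := by
        rw [← ofReal_norm, ← ofReal_norm, intervalIntegral.norm_intervalIntegral_eq]
    _ ≤ ∫⁻ s in Set.uIoc a b, ‖g' s‖ₑ := enorm_integral_le_lintegral_enorm _
    _ ≤ ∫⁻ s in Set.uIcc a b, ‖g' s‖ₑ := lintegral_mono_set Set.uIoc_subset_uIcc

/-- The bound `‖g 0‖ ≤ ‖g t‖ + ∫ ‖g'‖`, averaged over `t ∈ [0, δ]`. -/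
theorem enorm_le_lintegral_add_deriv {g g' : ℝ → ℂ} (hg : ∀ t, HasDerivAt g (g' t) t) {δ : ℝ}
    (hδ : 0 < δ) (hδ1 : δ ≤ 1) :
    ‖g 0‖ₑ ≤ (ENNReal.ofReal δ)⁻¹ * ∫⁻ t in Set.Icc 0 δ, (‖g t‖ₑ + ‖g' t‖ₑ) := by
  have hδ0 : ENNReal.ofReal δ ≠ 0 := by simpa using hδ
  have hmeas : Measurable g :=
    (continuous_iff_continuousAt.2 fun t => (hg t).continuousAt).measurable
  set J := ∫⁻ s in Set.Icc 0 δ, ‖g' s‖ₑ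
  have h1 : ∀ t ∈ Set.Icc 0 δ, ‖g 0‖ₑ ≤ ‖g t‖ₑ + J := by
    intro t ht
    have h2 := enorm_sub_le_lintegral_deriv hg t 0
    have h3 : Set.uIcc t 0 ⊆ Set.Icc 0 δ := by
      rw [Set.uIcc_of_ge ht.1]
      exact Set.Icc_subset_Icc_right ht.2
    calc ‖g 0‖ₑ = ‖g t + (g 0 - g t)‖ₑ := by rw [add_sub_cancel]
      _ ≤ ‖g t‖ₑ + ‖g 0 - g t‖ₑ := enorm_add_le _ _
      _ ≤ ‖g t‖ₑ + J := by
        gcongr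
        exact h2.trans (lintegral_mono_set h3)
  rw [mul_comm, ← div_eq_mul_inv, ENNReal.le_div_iff_mul_le (Or.inl hδ0) (Or.inl (by simp))]
  calc ‖g 0‖ₑ * ENNReal.ofReal δ = ∫⁻ _ in Set.Icc 0 δ, ‖g 0‖ₑ := by simp
    _ ≤ ∫⁻ t in Set.Icc 0 δ, (‖g t‖ₑ + J) := setLIntegral_mono' measurableSet_Icc h1
    _ = (∫⁻ t in Set.Icc 0 δ, ‖g t‖ₑ) + J * ENNReal.ofReal δ := by
        rw [lintegral_add_right _ measurable_const]; simp
    _ ≤ (∫⁻ t in Set.Icc 0 δ, ‖g t‖ₑ) + J * 1 := by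
        gcongr
        simpa using hδ1
    _ = ∫⁻ t in Set.Icc 0 δ, (‖g t‖ₑ + ‖g' t‖ₑ) := by
        rw [mul_one, lintegral_add_left hmeas.enorm]

theorem setLIntegral_pi_succ {m : ℕ} (S : Set ℝ) {φ : (Fin (m + 1) → ℝ) → ℝ≥0∞}
    (hφ : Measurable φ) :
    ∫⁻ r in Set.univ.pi fun _ : Fin (m + 1) => S, φ r =
      ∫⁻ t in S, ∫⁻ r in Set.univ.pi fun _ : Fin m => S, φ (Fin.cons t r) := by
  have hmp := (volume_preserving_piFinSuccAbove (fun _ : Fin (m + 1) => ℝ) 0).symm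
  have hpre : (MeasurableEquiv.piFinSuccAbove (fun _ : Fin (m + 1) => ℝ) 0).symm ⁻¹'
      (Set.univ.pi fun _ : Fin (m + 1) => S) = S ×ˢ (Set.univ.pi fun _ : Fin m => S) := by
    ext p
    simp [Set.mem_pi, Fin.forall_fin_succ]
  rw [← hmp.setLIntegral_comp_preimage_emb (MeasurableEquiv.measurableEmbedding _), hpre,
    Measure.volume_eq_prod, ← Measure.prod_restrict, lintegral_prod]
  · simp [Fin.insertNthEquiv]
  · exact (hφ.comp (MeasurableEquiv.measurable _)).aemeasurable

end OneVariable

section InvariantDerivatives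

variable {E : Type*} [NormedAddCommGroup E] [NormedSpace ℝ E] [FiniteDimensional ℝ E]
  {H : Type*} [TopologicalSpace H] {I : ModelWithCorners ℝ E H} [I.Boundaryless]
  {G : Type*} [TopologicalSpace G] [ChartedSpace H G] [Group G] [LieGroup I ∞ G] [T2Space G]

/-- Differentiability at `t = 0` for every base point gives differentiability along the whole
translate of the one-parameter subgroup. -/
theorem hasDerivAt_mul_lieExp {v : GroupLieAlgebra I G} {F : G → ℂ}
    (hF : ∀ x, DifferentiableAt ℝ (fun t : ℝ => F (x * lieExp (t • v))) 0) (x : G) (t : ℝ) :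
    HasDerivAt (fun t : ℝ => F (x * lieExp (t • v))) (invDeriv v F (x * lieExp (t • v))) t := by
  have h1 : HasDerivAt (fun s : ℝ => F (x * lieExp (t • v) * lieExp (s • v)))
      (invDeriv v F (x * lieExp (t • v))) (t - t) := by
    rw [sub_self]
    exact (hF (x * lieExp (t • v))).hasDerivAt
  have h2 := h1.comp_sub_const t t
  refine h2.congr_of_eventuallyEq (Eventually.of_forall fun s => ?_)
  simp only
  rw [mul_assoc, ← lieExp_add_smul, add_sub_cancel]

theorem iterInvDeriv_snoc {n : ℕ} (X : Fin n → GroupLieAlgebra I G) (k : ℕ) (α : Fin k → Fin n)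
    (i : Fin n) (f : G → ℂ) :
    iterInvDeriv X (k + 1) (Fin.snoc α i) f = invDeriv (X i) (iterInvDeriv X k α f) := by
  induction k generalizing f with
  | zero =>
    have : (Fin.snoc α i : Fin 1 → Fin n) 0 = i := rfl
    simp only [iterInvDeriv, this]
  | succ k ih =>
    rw [iterInvDeriv]
    have h1 : (fun j : Fin (k + 1) => (Fin.snoc α i : Fin (k + 2) → Fin n) j.succ) =
        (Fin.snoc (fun j => α j.succ) i : Fin (k + 1) → Fin n) := by
      funext j
      refine Fin.lastCases ?_ (fun j => ?_) j
      · rw [Fin.succ_last, Fin.snoc_last, Fin.snoc_last]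
      · rw [Fin.succ_castSucc, Fin.snoc_castSucc, Fin.snoc_castSucc]
    have h2 : (Fin.snoc α i : Fin (k + 2) → Fin n) 0 = α 0 :=
      Fin.snoc_castSucc (α := fun _ => Fin n) i α 0
    rw [h1, h2, ih, iterInvDeriv]

/-- A Sobolev type inequality along coordinates of the second kind: each further coordinate costs
one derivative. It holds at every point `x`, since only restrictions of the functions to
one-parameter subgroups are used. -/
theorem enorm_iterInvDeriv_le_lintegral [MeasurableSpace G] [BorelSpace G] {n N : ℕ}
    {X : Fin n → GroupLieAlgebra I G} {f : G → ℂ} (hf : RightDifferentiable X N f)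
    {h : G → ℝ≥0∞} (hh : Measurable h)
    (hfh : ∀ k, 1 ≤ k → k ≤ N → ∀ (α : Fin k → Fin n) (x : G), ‖iterInvDeriv X k α f x‖ₑ ≤ h x)
    {δ : ℝ} (hδ : 0 < δ) (hδ1 : δ ≤ 1) {m : ℕ} (d : Fin m → Fin n) {k : ℕ} (hk : 1 ≤ k)
    (hkm : k + m ≤ N) (α : Fin k → Fin n) (x : G) :
    ‖iterInvDeriv X k α f x‖ₑ ≤ (2 * (ENNReal.ofReal δ)⁻¹) ^ m *
      ∫⁻ r in Set.univ.pi fun _ : Fin m => Set.Icc 0 δ, h (x * expProd (fun i => X (d i)) r) := by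
  have : IsTopologicalGroup G := topologicalGroup_of_lieGroup I ∞
  induction m generalizing k x with
  | zero =>
    have h1 : ∀ r, expProd (fun i => X (d i)) r = (1 : G) := expProd_fin_zero _
    simp only [h1, mul_one, pow_zero, one_mul, lintegral_const, Measure.restrict_apply_univ]
    rw [volume_pi_pi, Finset.univ_eq_empty, Finset.prod_empty, mul_one]
    exact hfh k hk (by omega) α x
  | succ m ih =>
    set c : ℝ≥0∞ := 2 * (ENNReal.ofReal δ)⁻¹
    set d' : Fin m → Fin n := fun i => d i.succ
    have hc : c ≠ ⊤ := by
      have : ENNReal.ofReal δ ≠ 0 := by simpa using hδ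
      finiteness
    have hder := hasDerivAt_mul_lieExp (v := X (d 0)) (F := iterInvDeriv X k α f)
      (fun x => hf k (by omega) α (d 0) x) x
    have h1 := enorm_le_lintegral_add_deriv hder hδ hδ1
    simp only [lieExp_zero_smul, mul_one] at h1
    have h2 : ∀ t : ℝ, ‖iterInvDeriv X k α f (x * lieExp (t • X (d 0)))‖ₑ +
        ‖invDeriv (X (d 0)) (iterInvDeriv X k α f) (x * lieExp (t • X (d 0)))‖ₑ ≤
        2 * c ^ m * ∫⁻ r in Set.univ.pi fun _ : Fin m => Set.Icc 0 δ,
          h (x * lieExp (t • X (d 0)) * expProd (fun i => X (d' i)) r) := by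
      intro t
      rw [← iterInvDeriv_snoc, mul_assoc, two_mul]
      exact add_le_add (ih d' hk (by omega) α _) (ih d' (by omega) (by omega) _ _)
    have hm : Measurable fun r => h (x * expProd (fun i => X (d i)) r) :=
      hh.comp (continuous_const.mul (continuous_expProd _)).measurable
    calc ‖iterInvDeriv X k α f x‖ₑ ≤ (ENNReal.ofReal δ)⁻¹ * ∫⁻ t in Set.Icc 0 δ,
          2 * c ^ m * ∫⁻ r in Set.univ.pi fun _ : Fin m => Set.Icc 0 δ,
            h (x * lieExp (t • X (d 0)) * expProd (fun i => X (d' i)) r) :=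
          h1.trans (mul_le_mul' le_rfl (lintegral_mono h2))
      _ = c ^ (m + 1) * ∫⁻ r in Set.univ.pi fun _ : Fin (m + 1) => Set.Icc 0 δ,
            h (x * expProd (fun i => X (d i)) r) := by
          rw [setLIntegral_pi_succ _ hm, lintegral_const_mul' _ _ (by finiteness), ← mul_assoc]
          congr 1
          · rw [pow_succ]
            simp only [c]
            ring
          · simp only [expProd_succ, Fin.cons_zero, Fin.cons_succ, mul_assoc, d']

end InvariantDerivatives

/-! ### The estimate in one direction -/

section DirectionalEstimate

variable {E : Type*} [NormedAddCommGroup E] [NormedSpace ℝ E] [FiniteDimensional ℝ E]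
  {H : Type*} [TopologicalSpace H] {I : ModelWithCorners ℝ E H} [I.Boundaryless]
  {G : Type*} [TopologicalSpace G] [ChartedSpace H G] [Group G] [LieGroup I ∞ G] [T2Space G]
  [MeasurableSpace G] [BorelSpace G]

/-- The bound of Lebesgue measure by Haar measure on a small box extends to boxes that are long in
the first direction: these are covered by left translates of the small box. -/
theorem lintegral_lieExp_mul_expProd_le {μ : Measure G} [μ.IsMulLeftInvariant] {m : ℕ}
    {Y : Fin (m + 1) → GroupLieAlgebra I G} {δ : ℝ} (hδ : 0 < δ) {C : ℝ≥0∞}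
    (hC : ∀ h : G → ℝ≥0∞, Measurable h →
      ∫⁻ r in Set.univ.pi fun _ : Fin (m + 1) => Set.Icc 0 δ, h (expProd Y r) ≤ C * ∫⁻ x, h x ∂μ)
    (ε : ℝ) {h : G → ℝ≥0∞} (hh : Measurable h) :
    ∫⁻ s in Set.Icc (-ε) ε, ∫⁻ r in Set.univ.pi fun _ : Fin m => Set.Icc 0 δ,
      h (lieExp (s • Y 0) * expProd (fun i => Y i.succ) r) ≤
        (2 * ⌈ε / δ⌉₊ : ℕ) * C * ∫⁻ x, h x ∂μ := by
  have : IsTopologicalGroup G := topologicalGroup_of_lieGroup I ∞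
  set N := ⌈ε / δ⌉₊
  have hN : ε ≤ N * δ := (div_le_iff₀ hδ).1 (Nat.le_ceil _)
  set a : Fin (2 * N) → ℝ := fun k => ((k : ℝ) - N) * δ
  -- half-open, so that the right end point needs no interval of its own
  have hcover : Set.Ico (-ε) ε ⊆ ⋃ k, Set.Icc (a k) (a k + δ) := by
    intro s hs
    have h0 : 0 ≤ s / δ + N := by
      have : -(N : ℝ) ≤ s / δ := (le_div_iff₀ hδ).2 (by linarith [hs.1])
      linarith
    have h1 : s / δ < N := (div_lt_iff₀ hδ).2 (hs.2.trans_le hN)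
    have h2 := Nat.floor_le h0
    have h3 := Nat.lt_floor_add_one (s / δ + N)
    have hlt : ⌊s / δ + N⌋₊ < 2 * N := by
      rw [Nat.floor_lt h0]; push_cast; linarith
    have h4 : s = s / δ * δ := (div_mul_cancel₀ s hδ.ne').symm
    refine Set.mem_iUnion.2 ⟨⟨_, hlt⟩, ?_, ?_⟩ <;> simp only [a] <;> nlinarith
  have hpiece : ∀ k, ∫⁻ s in Set.Icc (a k) (a k + δ),
      ∫⁻ r in Set.univ.pi fun _ : Fin m => Set.Icc 0 δ,
        h (lieExp (s • Y 0) * expProd (fun i => Y i.succ) r) ≤ C * ∫⁻ x, h x ∂μ := by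
    intro k
    have hpre : (fun s => a k + s) ⁻¹' Set.Icc (a k) (a k + δ) = Set.Icc 0 δ := by
      rw [Set.preimage_const_add_Icc, sub_self, add_sub_cancel_left]
    have hg : Measurable fun x => h (lieExp (a k • Y 0) * x) := hh.comp (measurable_const_mul _)
    rw [← (measurePreserving_add_left volume (a k)).setLIntegral_comp_preimage_emb
      (measurableEmbedding_addLeft (a k)), hpre]
    refine le_trans (le_of_eq ?_) ((hC _ hg).trans_eq ?_)
    · rw [setLIntegral_pi_succ (φ := fun r => h (lieExp (a k • Y 0) * expProd Y r)) _
        (hg.comp (continuous_expProd Y).measurable)]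
      simp only [expProd_succ, Fin.cons_zero, Fin.cons_succ, lieExp_add_smul, mul_assoc]
    · rw [lintegral_mul_left_eq_self]
  calc _ = ∫⁻ s in Set.Ico (-ε) ε, ∫⁻ r in Set.univ.pi fun _ : Fin m => Set.Icc 0 δ,
        h (lieExp (s • Y 0) * expProd (fun i => Y i.succ) r) :=
        setLIntegral_congr Ico_ae_eq_Icc.symm
    _ ≤ ∫⁻ s in ⋃ k, Set.Icc (a k) (a k + δ), ∫⁻ r in Set.univ.pi fun _ : Fin m => Set.Icc 0 δ,
        h (lieExp (s • Y 0) * expProd (fun i => Y i.succ) r) := lintegral_mono_set hcover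
    _ ≤ ∑' k, ∫⁻ s in Set.Icc (a k) (a k + δ), ∫⁻ r in Set.univ.pi fun _ : Fin m => Set.Icc 0 δ,
        h (lieExp (s • Y 0) * expProd (fun i => Y i.succ) r) := lintegral_iUnion_le _ _
    _ ≤ ∑' _ : Fin (2 * N), C * ∫⁻ x, h x ∂μ := ENNReal.tsum_le_tsum hpiece
    _ = (2 * N : ℕ) * C * ∫⁻ x, h x ∂μ := by
        rw [tsum_fintype, Finset.sum_const, Finset.card_univ, Fintype.card_fin, nsmul_eq_mul,
          mul_assoc]

theorem lintegral_le_rpow_lintegral_sq_mul {α : Type*} [MeasurableSpace α] (ρ : Measure α)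
    {φ : α → ℝ≥0∞} (hφ : Measurable φ) :
    ∫⁻ a, φ a ∂ρ ≤ (∫⁻ a, φ a ^ (2 : ℝ) ∂ρ) ^ (1 / 2 : ℝ) * ρ Set.univ ^ (1 / 2 : ℝ) := by
  have h := ENNReal.lintegral_mul_le_Lp_mul_Lq ρ Real.HolderConjugate.two_two hφ.aemeasurable
    (measurable_const (a := (1 : ℝ≥0∞))).aemeasurable
  simpa using h

variable [SecondCountableTopology G]

/-- The integral of `D(X_j) f` over a segment of length `2ε` in the direction `X_j` is controlled by
the `L²` norm, near that segment, of a common majorant of the derivatives of `f`: the direction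
`X_j` is completed to coordinates of the second kind by the other `X_i`, and the factor
`A ε = O(ε ^ (1 / 2))` comes from the Cauchy-Schwarz inequality. -/
theorem exists_lintegral_invDeriv_le (μ : Measure G) [μ.IsHaarMeasure] {n : ℕ}
    (X : Module.Basis (Fin n) ℝ (GroupLieAlgebra I G)) (j : Fin n) :
    ∃ (A : ℝ → ℝ≥0∞) (T : ℝ → Set G), (∀ ε, A ε ≠ ⊤) ∧ Tendsto A (𝓝[>] 0) (𝓝 0) ∧
      (∀ ε, IsCompact (T ε)) ∧ Monotone T ∧
      ∀ f : G → ℂ, RightDifferentiable X n f → ∀ h : G → ℝ≥0∞, Measurable h →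
        (∀ k, 1 ≤ k → k ≤ n → ∀ (α : Fin k → Fin n) (x : G), ‖iterInvDeriv X k α f x‖ₑ ≤ h x) →
        ∀ (ε : ℝ) (z : G) (S : Set G), MeasurableSet S → (∀ t ∈ T ε, z * t ∈ S) →
          ∫⁻ s in Set.Icc (-ε) ε, ‖invDeriv (X j) f (z * lieExp (s • X j))‖ₑ ≤
            A ε * (∫⁻ y in S, h y ^ (2 : ℝ) ∂μ) ^ (1 / 2 : ℝ) := by
  have : IsTopologicalGroup G := topologicalGroup_of_lieGroup I ∞
  obtain _ | m := n
  · exact j.elim0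
  set σ := Equiv.swap 0 j
  set d : Fin m → Fin (m + 1) := fun i => σ i.succ
  set Y := X.reindex σ
  have hY0 : Y 0 = X j := by simp [Y, σ]
  have hYs : ∀ i : Fin m, Y i.succ = X (d i) := fun i => by simp [Y, d, σ]
  obtain ⟨δ, hδ, hδ1, C, hCt, hC⟩ := exists_lintegral_expProd_le μ Y
  set Q : Set (Fin m → ℝ) := Set.univ.pi fun _ : Fin m => Set.Icc 0 δ
  have hQm : MeasurableSet Q := MeasurableSet.univ_pi fun _ => measurableSet_Icc
  set Φ : (Fin m → ℝ) → G := expProd fun i => X (d i)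
  set ζ : ℝ × (Fin m → ℝ) → G := fun p => lieExp (p.1 • X j) * Φ p.2
  have hζ : Continuous ζ := ((continuous_lieExp_smul (X j)).comp continuous_fst).mul
    ((continuous_expProd _).comp continuous_snd)
  set c : ℝ≥0∞ := (2 * (ENNReal.ofReal δ)⁻¹) ^ m
  have hc : c ≠ ⊤ := by
    have : ENNReal.ofReal δ ≠ 0 := by simpa using hδ
    finiteness
  have hvQ : volume Q ≤ 1 := by
    rw [volume_pi_pi]
    exact Finset.prod_le_one' fun i _ => by simpa using hδ1
  set A : ℝ → ℝ≥0∞ := fun ε =>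
    c * (((2 * ⌈ε / δ⌉₊ : ℕ) * C) ^ (1 / 2 : ℝ) * ENNReal.ofReal (2 * ε) ^ (1 / 2 : ℝ))
  refine ⟨A, fun ε => ζ '' (Set.Icc (-ε) ε ×ˢ Q), fun ε => ?_, ?_, fun ε => ?_, ?_, ?_⟩
  · have h1 : ((2 * ⌈ε / δ⌉₊ : ℕ) : ℝ≥0∞) * C ≠ ⊤ := by finiteness
    exact ENNReal.mul_ne_top hc (ENNReal.mul_ne_top (ENNReal.rpow_ne_top_of_nonneg (by norm_num) h1)
      (ENNReal.rpow_ne_top_of_nonneg (by norm_num) (by finiteness)))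
  -- for `ε < δ` the number of translates is at most `2`, so the first factor stays bounded
  · have hlim : Tendsto (fun ε : ℝ => c * ((2 * C) ^ (1 / 2 : ℝ) *
        ENNReal.ofReal (2 * ε) ^ (1 / 2 : ℝ))) (𝓝[>] 0) (𝓝 0) := by
      have h1 : Tendsto (fun ε : ℝ => ENNReal.ofReal (2 * ε) ^ (1 / 2 : ℝ)) (𝓝 0) (𝓝 0) := by
        have : Continuous fun ε : ℝ => ENNReal.ofReal (2 * ε) ^ (1 / 2 : ℝ) :=
          ENNReal.continuous_rpow_const.comp
            (ENNReal.continuous_ofReal.comp (continuous_const.mul continuous_id))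
        simpa using this.tendsto 0
      have h2 : (2 * C) ^ (1 / 2 : ℝ) ≠ ⊤ :=
        ENNReal.rpow_ne_top_of_nonneg (by norm_num) (by finiteness)
      have h3 := ENNReal.Tendsto.const_mul (a := c) (ENNReal.Tendsto.const_mul
        (a := (2 * C) ^ (1 / 2 : ℝ)) h1 (Or.inr h2)) (Or.inr hc)
      simp only [mul_zero] at h3
      exact h3.mono_left nhdsWithin_le_nhds
    refine tendsto_of_tendsto_of_tendsto_of_le_of_le' tendsto_const_nhds hlim
      (Eventually.of_forall fun _ => zero_le) ?_
    filter_upwards [Ioo_mem_nhdsGT hδ] with ε hε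
    have h1 : ⌈ε / δ⌉₊ ≤ 1 := Nat.ceil_le.2 (by
      rw [Nat.cast_one, div_le_one hδ]
      exact hε.2.le)
    have h2 : ((2 * ⌈ε / δ⌉₊ : ℕ) : ℝ≥0∞) ≤ 2 := by exact_mod_cast (by omega)
    simp only [A]
    gcongr
  · exact (isCompact_Icc.prod (isCompact_univ_pi fun _ => isCompact_Icc)).image hζ
  · intro ε ε' hε
    exact Set.image_mono (Set.prod_mono (Set.Icc_subset_Icc (by linarith) hε) le_rfl)
  · intro f hf h hh hfh ε z S hS hTS
    set ρ : Measure (ℝ × (Fin m → ℝ)) :=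
      (volume.restrict (Set.Icc (-ε) ε)).prod (volume.restrict Q)
    have hρ : ρ Set.univ ≤ ENNReal.ofReal (2 * ε) := by
      rw [← Set.univ_prod_univ, Measure.prod_prod, Measure.restrict_apply_univ,
        Measure.restrict_apply_univ, Real.volume_Icc, sub_neg_eq_add, ← two_mul]
      exact mul_le_of_le_one_right' hvQ
    have hzζ : Measurable fun p => h (z * ζ p) :=
      hh.comp (continuous_const.mul hζ).measurable
    -- the square of the majorant, cut off outside `S` and moved to the base point
    set q : G → ℝ≥0∞ := fun x => S.indicator (fun y => h y ^ (2 : ℝ)) (z * x)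
    have hq0 : Measurable (S.indicator fun y => h y ^ (2 : ℝ)) :=
      (hh.pow_const _).indicator hS
    have hq : Measurable q := hq0.comp (measurable_const_mul z)
    have hsq : ∫⁻ p, h (z * ζ p) ^ (2 : ℝ) ∂ρ ≤
        (2 * ⌈ε / δ⌉₊ : ℕ) * C * ∫⁻ y in S, h y ^ (2 : ℝ) ∂μ := by
      calc ∫⁻ p, h (z * ζ p) ^ (2 : ℝ) ∂ρ
          = ∫⁻ s in Set.Icc (-ε) ε, ∫⁻ r in Q, h (z * ζ (s, r)) ^ (2 : ℝ) :=
            lintegral_prod _ (hzζ.pow_const _).aemeasurable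
        _ ≤ ∫⁻ s in Set.Icc (-ε) ε, ∫⁻ r in Q, q (lieExp (s • Y 0) *
              expProd (fun i => Y i.succ) r) := by
            refine setLIntegral_mono' measurableSet_Icc fun s hs =>
              setLIntegral_mono' hQm fun r hr => le_of_eq ?_
            have hmem : z * ζ (s, r) ∈ S := hTS _ ⟨(s, r), ⟨hs, hr⟩, rfl⟩
            simp only [q, hY0, hYs]
            exact (Set.indicator_of_mem hmem fun y => h y ^ (2 : ℝ)).symm
        _ ≤ (2 * ⌈ε / δ⌉₊ : ℕ) * C * ∫⁻ x, q x ∂μ := lintegral_lieExp_mul_expProd_le hδ hC ε hq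
        _ = (2 * ⌈ε / δ⌉₊ : ℕ) * C * ∫⁻ y in S, h y ^ (2 : ℝ) ∂μ := by
            rw [lintegral_mul_left_eq_self (S.indicator fun y => h y ^ (2 : ℝ)),
              lintegral_indicator hS]
    calc ∫⁻ s in Set.Icc (-ε) ε, ‖invDeriv (X j) f (z * lieExp (s • X j))‖ₑ
        ≤ ∫⁻ s in Set.Icc (-ε) ε, c * ∫⁻ r in Q, h (z * ζ (s, r)) := by
          refine lintegral_mono fun s => ?_
          have h1 := enorm_iterInvDeriv_le_lintegral hf hh hfh hδ hδ1 d (k := 1) le_rfl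
            (by omega) (fun _ => j) (z * lieExp (s • X j))
          simpa only [iterInvDeriv, mul_assoc] using h1
      _ = c * ∫⁻ p, h (z * ζ p) ∂ρ := by
          rw [lintegral_const_mul' _ _ hc, lintegral_prod _ hzζ.aemeasurable]
      _ ≤ c * ((∫⁻ p, h (z * ζ p) ^ (2 : ℝ) ∂ρ) ^ (1 / 2 : ℝ) * ρ Set.univ ^ (1 / 2 : ℝ)) :=
          mul_le_mul' le_rfl (lintegral_le_rpow_lintegral_sq_mul ρ hzζ)
      _ ≤ c * (((2 * ⌈ε / δ⌉₊ : ℕ) * C * ∫⁻ y in S, h y ^ (2 : ℝ) ∂μ) ^ (1 / 2 : ℝ) *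
            ENNReal.ofReal (2 * ε) ^ (1 / 2 : ℝ)) := by
          gcongr
      _ = A ε * (∫⁻ y in S, h y ^ (2 : ℝ) ∂μ) ^ (1 / 2 : ℝ) := by
          simp only [A]
          rw [ENNReal.mul_rpow_of_nonneg _ _ (by norm_num : (0 : ℝ) ≤ 1 / 2)]
          ring

end DirectionalEstimate

/-! ### The oscillation -/

section Oscillation

open scoped Pointwise

variable {E : Type*} [NormedAddCommGroup E] [NormedSpace ℝ E] [FiniteDimensional ℝ E]
  {H : Type*} [TopologicalSpace H] {I : ModelWithCorners ℝ E H} [I.Boundaryless]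
  {G : Type*} [TopologicalSpace G] [ChartedSpace H G] [Group G] [LieGroup I ∞ G] [T2Space G]

theorem isCompact_expBox {n : ℕ} (X : Fin n → GroupLieAlgebra I G) (ε : ℝ) :
    IsCompact (expBox X ε) := by
  have h : expBox X ε = expProd X '' Set.univ.pi fun _ => Set.Icc (-ε) ε := by
    ext u
    simp only [expBox, Set.mem_ofPred_eq, Set.mem_image, Set.mem_univ_pi, Set.mem_Icc]
    exact exists_congr fun t => and_congr_right fun _ => eq_comm
  rw [h]
  exact (isCompact_univ_pi fun _ => isCompact_Icc).image (continuous_expProd X)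

theorem expBox_mono {n : ℕ} (X : Fin n → GroupLieAlgebra I G) : Monotone (expBox X) := by
  rintro ε ε' hε u ⟨t, ht, rfl⟩
  exact ⟨t, fun k => ⟨by linarith [(ht k).1], (ht k).2.trans hε⟩, rfl⟩

/-- Telescoping along `y, y exp (t₁ Y₁), y exp (t₁ Y₁) exp (t₂ Y₂), …`, which are the base points
`z j`. -/
theorem exists_enorm_sub_le_sum_lintegral {m : ℕ} {Y : Fin m → GroupLieAlgebra I G} {f : G → ℂ}
    (hf : ∀ i x, DifferentiableAt ℝ (fun t : ℝ => f (x * lieExp (t • Y i))) 0) {ε : ℝ}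
    {t : Fin m → ℝ} (ht : ∀ k, -ε ≤ t k ∧ t k ≤ ε) (y : G) :
    ∃ z : Fin m → G, (∀ j, y⁻¹ * z j ∈ expBox Y ε) ∧
      ‖f (y * expProd Y t) - f y‖ₑ ≤
        ∑ j, ∫⁻ s in Set.Icc (-ε) ε, ‖invDeriv (Y j) f (z j * lieExp (s • Y j))‖ₑ := by
  induction m generalizing y with
  | zero => exact ⟨fun _ => y, fun j => j.elim0, by simp [expProd_fin_zero]⟩
  | succ m ih =>
    set y' := y * lieExp (t 0 • Y 0)
    obtain ⟨z, hz, hle⟩ := ih (Y := fun i => Y i.succ) (fun i x => hf i.succ x)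
      (t := fun i => t i.succ) (fun k => ht k.succ) y'
    have hε : 0 ≤ ε := by linarith [(ht 0).1, (ht 0).2]
    refine ⟨Fin.cons y z, fun j => ?_, ?_⟩
    · refine Fin.cases ?_ (fun j => ?_) j
      · refine ⟨0, fun _ => ⟨by simpa using hε, hε⟩, ?_⟩
        rw [Fin.cons_zero, inv_mul_cancel]
        exact (expProd_zero Y).symm
      · obtain ⟨r, hr, hzr⟩ := hz j
        refine ⟨Fin.cons (t 0) r, fun k => ?_, ?_⟩
        · refine Fin.cases ?_ (fun k => ?_) k
          · exact ht 0
          · exact hr k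
        · change _ = expProd Y (Fin.cons (t 0) r)
          have h1 : expProd (fun i => Y i.succ) r = y'⁻¹ * z j := hzr.symm
          simp only [expProd_succ, Fin.cons_zero, Fin.cons_succ, h1, y']
          group
    · have h0 : ‖f y' - f y‖ₑ ≤
          ∫⁻ s in Set.Icc (-ε) ε, ‖invDeriv (Y 0) f (y * lieExp (s • Y 0))‖ₑ := by
        have h1 := enorm_sub_le_lintegral_deriv (hasDerivAt_mul_lieExp (hf 0) y) 0 (t 0)
        simp only [lieExp_zero_smul, mul_one] at h1
        exact h1.trans (lintegral_mono_set
          (Set.uIcc_subset_Icc ⟨by simpa using hε, hε⟩ (ht 0)))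
      rw [Fin.sum_univ_succ]
      simp only [Fin.cons_zero, Fin.cons_succ]
      have h2 : y * expProd Y t = y' * expProd (fun i => Y i.succ) (fun i => t i.succ) := by
        rw [expProd_succ, mul_assoc]
      calc ‖f (y * expProd Y t) - f y‖ₑ
          = ‖(f y' - f y) + (f (y * expProd Y t) - f y')‖ₑ := by congr 1; ring
        _ ≤ ‖f y' - f y‖ₑ + ‖f (y * expProd Y t) - f y'‖ₑ := enorm_add_le _ _
        _ ≤ _ := by
          refine add_le_add h0 ?_
          rw [h2]
          exact hle

theorem exists_measurable_ge_ae_eq {α : Type*} [MeasurableSpace α] {ν : Measure α}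
    {φ : α → ℝ≥0∞} (hφ : AEMeasurable φ ν) :
    ∃ g : α → ℝ≥0∞, Measurable g ∧ φ ≤ g ∧ φ =ᵐ[ν] g := by
  classical
  set B := toMeasurable ν {a | φ a ≠ hφ.mk φ a}
  have hB : ν B = 0 := by
    rw [measure_toMeasurable]
    exact hφ.ae_eq_mk
  refine ⟨B.piecewise (fun _ => ⊤) (hφ.mk φ), Measurable.piecewise (measurableSet_toMeasurable _ _)
    measurable_const hφ.measurable_mk, fun a => ?_, ?_⟩
  · by_cases ha : a ∈ B
    · simp [ha]
    · have : φ a = hφ.mk φ a := by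
        by_contra hne
        exact ha (subset_toMeasurable _ _ hne)
      simp [ha, this]
  · filter_upwards [hφ.ae_eq_mk, measure_eq_zero_iff_ae_notMem.1 hB] with a ha haB
    simp [haB, ha]

/-- The derivatives `D^α f`, `1 ≤ |α| ≤ n`, have a common Borel majorant whose `L²` norm is at most
the sum of theirs. -/
theorem exists_measurable_majorant [MeasurableSpace G] {μ : Measure G} {n : ℕ} {X : Fin n → GroupLieAlgebra I G}
    {f : G → ℂ} (hf : ∀ k ≤ n, ∀ α : Fin k → Fin n, MemLp (iterInvDeriv X k α f) 2 μ) :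
    ∃ h : G → ℝ≥0∞, Measurable h ∧
      (∀ k, 1 ≤ k → k ≤ n → ∀ (α : Fin k → Fin n) (x : G), ‖iterInvDeriv X k α f x‖ₑ ≤ h x) ∧
      (∫⁻ x, h x ^ (2 : ℝ) ∂μ) ^ (1 / 2 : ℝ) ≤
        ∑ k ∈ Finset.Icc 1 n, ∑ α : Fin k → Fin n, eLpNorm (iterInvDeriv X k α f) 2 μ := by
  have hex : ∀ k (α : Fin k → Fin n), ∃ g : G → ℝ≥0∞, Measurable g ∧ (k ≤ n →
      (∀ x, ‖iterInvDeriv X k α f x‖ₑ ≤ g x) ∧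
        eLpNorm g 2 μ = eLpNorm (iterInvDeriv X k α f) 2 μ) := by
    intro k α
    by_cases hk : k ≤ n
    · obtain ⟨g, hg, hle, hae⟩ := exists_measurable_ge_ae_eq (hf k hk α).1.enorm
      refine ⟨g, hg, fun _ => ⟨hle, ?_⟩⟩
      rw [← eLpNorm_enorm]
      exact (eLpNorm_congr_ae hae).symm
    · exact ⟨0, measurable_const, fun h => absurd h hk⟩
  choose g hg hgk using hex
  have hm : ∀ k, Measurable (∑ α : Fin k → Fin n, g k α) := fun k => by
    rw [Finset.sum_fn]
    exact Finset.measurable_sum _ fun α _ => hg k α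
  refine ⟨∑ k ∈ Finset.Icc 1 n, ∑ α : Fin k → Fin n, g k α,
    ?_, fun k h1 hk α x => ?_, ?_⟩
  · rw [Finset.sum_fn]
    exact Finset.measurable_sum _ fun k _ => hm k
  · simp only [Finset.sum_apply]
    calc ‖iterInvDeriv X k α f x‖ₑ ≤ g k α x := (hgk k α hk).1 x
      _ ≤ ∑ α, g k α x := Finset.single_le_sum (f := fun α => g k α x) (fun _ _ => zero_le)
          (Finset.mem_univ α)
      _ ≤ _ := Finset.single_le_sum (f := fun k => ∑ α, g k α x) (fun _ _ => zero_le)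
          (Finset.mem_Icc.2 ⟨h1, hk⟩)
  · calc _ = eLpNorm (∑ k ∈ Finset.Icc 1 n, ∑ α : Fin k → Fin n, g k α) 2 μ := by
          rw [eLpNorm_eq_lintegral_rpow_enorm_toReal (by norm_num) (by norm_num)]
          simp
      _ ≤ ∑ k ∈ Finset.Icc 1 n, eLpNorm (∑ α : Fin k → Fin n, g k α) 2 μ :=
          eLpNorm_sum_le (fun k _ => (hm k).aestronglyMeasurable) (by norm_num)
      _ ≤ ∑ k ∈ Finset.Icc 1 n, ∑ α : Fin k → Fin n, eLpNorm (g k α) 2 μ :=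
          Finset.sum_le_sum fun k _ =>
            eLpNorm_sum_le (fun α _ => (hg k α).aestronglyMeasurable) (by norm_num)
      _ = _ := Finset.sum_congr rfl fun k hk => Finset.sum_congr rfl fun α _ =>
          (hgk k α (Finset.mem_Icc.1 hk).2).2

variable [SecondCountableTopology G] [MeasurableSpace G] [BorelSpace G]

/-- The pointwise estimate: the oscillation of `f` at `x` is controlled by the `L²` norm, over the
translate by `x` of a compact set, of a common majorant of the derivatives of `f`. -/
theorem exists_enorm_sub_mul_inv_le (μ : Measure G) [μ.IsHaarMeasure] {n : ℕ}
    (X : Module.Basis (Fin n) ℝ (GroupLieAlgebra I G)) :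
    ∃ (A : ℝ → ℝ≥0∞) (V : ℝ → Set G), (∀ ε, A ε ≠ ⊤) ∧ Tendsto A (𝓝[>] 0) (𝓝 0) ∧
      (∀ ε, IsCompact (V ε)) ∧ Monotone V ∧
      ∀ f : G → ℂ, RightDifferentiable X n f → ∀ h : G → ℝ≥0∞, Measurable h →
        (∀ k, 1 ≤ k → k ≤ n → ∀ (α : Fin k → Fin n) (x : G), ‖iterInvDeriv X k α f x‖ₑ ≤ h x) →
        ∀ (ε : ℝ) (x u : G), u ∈ expBox X ε →
          ‖f x - f (x * u⁻¹)‖ₑ ≤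
            A ε * (∫⁻ y in (x⁻¹ * ·) ⁻¹' V ε, h y ^ (2 : ℝ) ∂μ) ^ (1 / 2 : ℝ) := by
  have : IsTopologicalGroup G := topologicalGroup_of_lieGroup I ∞
  choose A T hA hA0 hT hTm hAT using fun j => exists_lintegral_invDeriv_le μ X j
  refine ⟨fun ε => ∑ j, A j ε, fun ε => ⋃ j, (expBox X ε)⁻¹ * expBox X ε * T j ε,
    fun ε => ENNReal.sum_ne_top.2 fun j _ => hA j ε, ?_, fun ε => ?_, ?_, ?_⟩
  · simpa using tendsto_finsetSum Finset.univ fun j _ => hA0 j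
  · exact isCompact_iUnion fun j =>
      ((isCompact_expBox _ ε).inv.mul (isCompact_expBox _ ε)).mul (hT j ε)
  · intro ε ε' hε
    have h1 := expBox_mono X hε
    exact Set.iUnion_mono fun j => Set.mul_subset_mul
      (Set.mul_subset_mul (Set.inv_subset_inv.2 h1) h1) (hTm j hε)
  · intro f hf h hh hfh ε x u hu
    obtain ⟨t, ht, hut⟩ := id hu
    obtain ⟨z, hz, hle⟩ := exists_enorm_sub_le_sum_lintegral (Y := X) (f := f)
      (fun i y => hf 0 i.pos Fin.elim0 i y) ht (x * u⁻¹)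
    have hx : x * u⁻¹ * expProd X t = x := by
      have : u = expProd X t := hut
      rw [← this, inv_mul_cancel_right]
    rw [hx] at hle
    refine hle.trans ?_
    rw [Finset.sum_mul]
    refine Finset.sum_le_sum fun j _ => hAT j f hf h hh hfh ε (z j) _ ?_ fun s hs => ?_
    · refine measurable_const_mul x⁻¹ (IsCompact.measurableSet ?_)
      exact isCompact_iUnion fun j =>
        ((isCompact_expBox _ ε).inv.mul (isCompact_expBox _ ε)).mul (hT j ε)
    · refine Set.mem_iUnion.2 ⟨j, u⁻¹ * ((x * u⁻¹)⁻¹ * z j),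
        Set.mul_mem_mul (Set.inv_mem_inv.2 hu) (hz j), s, hs, ?_⟩
      simp only
      group

/-- By left invariance, averaging the mass of the translates `xV` does not involve the modular
function: `y ∈ xV` means `x ∈ yV⁻¹`. -/
theorem lintegral_setLIntegral_translate {G : Type*} [Group G] [MeasurableSpace G]
    [MeasurableMul₂ G] [MeasurableInv G] (μ : Measure G) [SFinite μ] [μ.IsMulLeftInvariant]
    {V : Set G} (hV : MeasurableSet V) {φ : G → ℝ≥0∞} (hφ : Measurable φ) :
    ∫⁻ x, ∫⁻ y in (x⁻¹ * ·) ⁻¹' V, φ y ∂μ ∂μ = μ V⁻¹ * ∫⁻ y, φ y ∂μ := by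
  have hm : Measurable fun p : G × G => p.1⁻¹ * p.2 := by fun_prop
  have h1 : ∀ x, ∫⁻ y in (x⁻¹ * ·) ⁻¹' V, φ y ∂μ =
      ∫⁻ y, V.indicator (fun _ => φ y) (x⁻¹ * y) ∂μ := fun x => by
    rw [← lintegral_indicator (measurable_const_mul x⁻¹ hV)]
    rfl
  have h2 : Measurable (Function.uncurry fun x y : G => V.indicator (fun _ => φ y) (x⁻¹ * y)) := by
    have : (Function.uncurry fun x y : G => V.indicator (fun _ => φ y) (x⁻¹ * y)) =
        ((fun p : G × G => p.1⁻¹ * p.2) ⁻¹' V).indicator fun p => φ p.2 := rfl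
    rw [this]
    exact (hφ.comp measurable_snd).indicator (hm hV)
  have h3 : ∀ y, ∫⁻ x, V.indicator (fun _ => φ y) (x⁻¹ * y) ∂μ = μ V⁻¹ * φ y := fun y => by
    have : (fun x : G => V.indicator (fun _ => φ y) (x⁻¹ * y)) =
        ((y⁻¹ * ·) ⁻¹' V⁻¹).indicator fun _ => φ y := by
      ext x
      have hiff : x ∈ (y⁻¹ * ·) ⁻¹' V⁻¹ ↔ x⁻¹ * y ∈ V := by
        rw [Set.mem_preimage, Set.mem_inv, mul_inv_rev, inv_inv]
      by_cases hx : x⁻¹ * y ∈ V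
      · rw [Set.indicator_of_mem hx, Set.indicator_of_mem (hiff.2 hx)]
      · rw [Set.indicator_of_notMem hx, Set.indicator_of_notMem (hiff.not.2 hx)]
    rw [this, lintegral_indicator_const (measurable_const_mul y⁻¹ hV.inv), measure_preimage_mul,
      mul_comm]
  simp only [h1]
  rw [lintegral_lintegral_swap h2.aemeasurable]
  simp only [h3]
  exact lintegral_const_mul _ hφ

theorem lowerSemicontinuous_localOsc {G : Type*} [TopologicalSpace G] [Group G]
    [IsTopologicalGroup G] (U : Set G) {f : G → ℂ} (hf : Continuous f) :
    LowerSemicontinuous (localOsc U f) :=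
  lowerSemicontinuous_biSup fun u _ =>
    (continuous_enorm.comp
      (hf.sub (hf.comp (continuous_mul_const u⁻¹)))).lowerSemicontinuous

end Oscillation

theorem mainTheorem5
    {E : Type*} [NormedAddCommGroup E] [NormedSpace ℝ E] [FiniteDimensional ℝ E]
    {H : Type*} [TopologicalSpace H] (I : ModelWithCorners ℝ E H) [I.Boundaryless]
    {G : Type*} [TopologicalSpace G] [ChartedSpace H G] [Group G] [LieGroup I ∞ G]
    [T2Space G] [SecondCountableTopology G] [MeasurableSpace G] [BorelSpace G]
    (μ : Measure G) [μ.IsHaarMeasure]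
    {n : ℕ} (X : Module.Basis (Fin n) ℝ (GroupLieAlgebra I G)) :
    ∃ C : ℝ → ℝ≥0, Tendsto C (𝓝[>] 0) (𝓝 0) ∧
      ∀ f : G → ℂ, RightDifferentiable X n f →
        (∀ k ≤ n, ∀ α : Fin k → Fin n, MemLp (iterInvDeriv X k α f) 2 μ) →
        ∀ ε : ℝ, 0 < ε →
          MemLp (localOsc (expBox X ε) f) 2 μ ∧
          eLpNorm (localOsc (expBox X ε) f) 2 μ ≤
            C ε * ∑ k ∈ Finset.Icc 1 n, ∑ α : Fin k → Fin n,
              eLpNorm (iterInvDeriv X k α f) 2 μ := by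
  have : IsTopologicalGroup G := topologicalGroup_of_lieGroup I ∞
  have : LocallyCompactSpace G := Manifold.locallyCompact_of_finiteDimensional I
  obtain ⟨A, V, hA, hA0, hV, hVm, hmain⟩ := exists_enorm_sub_mul_inv_le μ X
  set B : ℝ → ℝ≥0∞ := fun ε => μ (V ε)⁻¹ ^ (1 / 2 : ℝ)
  have hB : ∀ ε, B ε ≠ ⊤ := fun ε =>
    ENNReal.rpow_ne_top_of_nonneg (by norm_num) (hV ε).inv.measure_lt_top.ne
  have hAB : Tendsto (fun ε => A ε * B ε) (𝓝[>] 0) (𝓝 0) := by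
    have h1 : Tendsto (fun ε => A ε * B 1) (𝓝[>] 0) (𝓝 0) := by
      simpa using ENNReal.Tendsto.mul_const hA0 (Or.inr (hB 1))
    refine tendsto_of_tendsto_of_tendsto_of_le_of_le' tendsto_const_nhds h1
      (Eventually.of_forall fun _ => zero_le) ?_
    filter_upwards [Ioo_mem_nhdsGT one_pos] with ε hε
    have : (V ε)⁻¹ ⊆ (V 1)⁻¹ := Set.inv_subset_inv.2 (hVm hε.2.le)
    simp only [B]
    gcongr
  refine ⟨fun ε => (A ε * B ε).toNNReal,
    (ENNReal.tendsto_toNNReal ENNReal.zero_ne_top).comp hAB, fun f hf hfL ε hε => ?_⟩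
  obtain ⟨h, hh, hfh, hnorm⟩ := exists_measurable_majorant hfL
  set D := ∑ k ∈ Finset.Icc 1 n, ∑ α : Fin k → Fin n, eLpNorm (iterInvDeriv X k α f) 2 μ
  have hD : D ≠ ⊤ := ENNReal.sum_ne_top.2 fun k hk => ENNReal.sum_ne_top.2 fun α _ =>
    (hfL k (Finset.mem_Icc.1 hk).2 α).2.ne
  have hpt := hmain f hf h hh hfh
  -- the pointwise estimate is uniform in the base point
  -- (the mass of a translate is at most the total mass), whence `f` is continuous and its
  -- oscillation, a supremum over an uncountable set, is measurable
  have hcont : Continuous f := by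
    refine continuous_iff_continuousAt.2 fun x => EMetric.tendsto_nhds.2 fun η hη => ?_
    have h1 : Tendsto (fun ε => A ε * D) (𝓝[>] 0) (𝓝 0) := by
      simpa using ENNReal.Tendsto.mul_const hA0 (Or.inr hD)
    obtain ⟨ε', hlt, hε'⟩ := ((h1.eventually_lt_const hη).and self_mem_nhdsWithin).exists
    have hnhds : ∀ᶠ y in 𝓝 x, y⁻¹ * x ∈ expBox X ε' := by
      have h2 : ContinuousAt (fun y : G => y⁻¹ * x) x := by fun_prop
      exact h2.eventually_mem (by rw [inv_mul_cancel]; exact expBox_mem_nhds_one X hε')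
    filter_upwards [hnhds] with y hy
    have h3 := hpt ε' x _ hy
    rw [mul_inv_rev, inv_inv, mul_inv_cancel_left] at h3
    rw [edist_comm, edist_eq_enorm_sub]
    refine (h3.trans (mul_le_mul' le_rfl (le_trans ?_ hnorm))).trans_lt hlt
    gcongr
    exact Measure.restrict_le_self
  have hle : eLpNorm (localOsc (expBox X ε) f) 2 μ ≤ (A ε * B ε) * D := by
    calc eLpNorm (localOsc (expBox X ε) f) 2 μ
        = (∫⁻ x, localOsc (expBox X ε) f x ^ (2 : ℝ) ∂μ) ^ (1 / 2 : ℝ) := by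
          rw [eLpNorm_eq_lintegral_rpow_enorm_toReal (by norm_num) (by norm_num)]
          simp
      _ ≤ (∫⁻ x, A ε ^ (2 : ℝ) * ∫⁻ y in (x⁻¹ * ·) ⁻¹' V ε, h y ^ (2 : ℝ) ∂μ ∂μ) ^
            (1 / 2 : ℝ) := by
          gcongr with x
          have h1 : localOsc (expBox X ε) f x ≤
              A ε * (∫⁻ y in (x⁻¹ * ·) ⁻¹' V ε, h y ^ (2 : ℝ) ∂μ) ^ (1 / 2 : ℝ) :=
            iSup₂_le fun u hu => hpt ε x u hu
          refine (ENNReal.rpow_le_rpow h1 (by norm_num)).trans_eq ?_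
          rw [ENNReal.mul_rpow_of_nonneg _ _ (by norm_num), ← ENNReal.rpow_mul]
          norm_num
      _ = (A ε * B ε) * (∫⁻ y, h y ^ (2 : ℝ) ∂μ) ^ (1 / 2 : ℝ) := by
          rw [lintegral_const_mul' _ _ (ENNReal.rpow_ne_top_of_nonneg (by norm_num) (hA ε)),
            lintegral_setLIntegral_translate μ (hV ε).measurableSet (hh.pow_const _),
            ENNReal.mul_rpow_of_nonneg _ _ (by norm_num),
            ENNReal.mul_rpow_of_nonneg _ _ (by norm_num), ← ENNReal.rpow_mul, ← mul_assoc]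
          norm_num [B]
      _ ≤ (A ε * B ε) * D := mul_le_mul' le_rfl hnorm
  have hABt : A ε * B ε ≠ ⊤ := ENNReal.mul_ne_top (hA ε) (hB ε)
  refine ⟨⟨(lowerSemicontinuous_localOsc _ hcont).measurable.aestronglyMeasurable,
    hle.trans_lt (ENNReal.mul_lt_top hABt.lt_top hD.lt_top)⟩, ?_⟩
  rwa [ENNReal.coe_toNNReal hABt]
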